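/- **Definitions.** Let $P_1,\dots,P_N$ be players and let $\Gamma=\{\alpha_1,\dots,\alpha_r\}$ ($r\ge 1$) be an access structure, i.e. the family of all sets of players that are to be authorized; authorized sets are non-empty. $\Gamma$ is *monotone* if every set of players that contains a member of $\Gamma$ belongs to $\Gamma$. A *partial link classification* of $\Gamma$ is a partition of $\Gamma$ into classes such that any two members of the same class intersect, while any two distinct classes contain a pair of disjoint sets, one from each. Let $\lambda$ be the smallest number of classes in a partial link classification of $\Gamma$; equivalently, $\lambda$ is the minimum number of cliques into which the graph on $\Gamma$, whose edges join intersecting sets, can be partitioned. Fix a secret system of dimension $d\ge 2$. A *scheme* is a quantum channel (a completely positive trace-preserving map) that encodes the secret into finitely many finite-dimensional quantum shares, each of which is given to a player or kept by the dealer as a *home share*. A set of shares *can recover the secret* if some channel maps its reduced state back to the secret state, for every secret state; it *has no information* if its reduced state is the same for all secret states. An *assisted quantum secret sharing (AQSS) scheme* for $\Gamma$ is a scheme, not all of whose shares are home shares, such that for every set $A$ of players the shares of $A$ together with all home shares can recover the secret if $A\in\Gamma$, and have no information if $A\notin\Gamma$. It is *conventional* if it has no home shares. A $((k,n))$ *quantum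 threshold scheme* encodes the secret into $n$ shares such that any $k$ or more of them can recover the secret and any fewer than $k$ have no information. **Theorem.** For every $d\ge 2$ and every $\Gamma$ as above (its members may be mutually disjoint): 1. An AQSS scheme for $\Gamma$ exists if and only if $\Gamma$ is monotone. 2. If $\Gamma$ is monotone, there is an AQSS scheme for $\Gamma$ with at most $\lambda-1$ home shares. 3. More precisely, let $\Gamma$ be monotone and let $C_1,\dots,C_\lambda$ be any partial link classification of $\Gamma$ of the minimum size $\lambda$. Then there are a $((\lambda,2\lambda-1))$ quantum threshold scheme for the secret, an assignment of distinct shares of it to the classes, and for each $i$ a conventional quantum secret sharing scheme for the access structure $\{A : A\supseteq\alpha\text{ for some }\alpha\in C_i\}$ whose secret is the share assigned to $C_i$, such that the following is an AQSS scheme for $\Gamma$ with exactly $\lambda-1$ home shares: encode the secret by the threshold scheme, encode the share of each class $C_i$ by the scheme of that class, and keep each of the $\lambda-1$ remaining shares as one home share. -/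

import Mathlib

namespace AQSS

open scoped ComplexOrder

/-! ### States and channels on finite-dimensional quantum systems

A quantum system with orthonormal basis indexed by a finite type `n` has operators
`Matrix n n ℂ`. A composite system with factors `X i` has basis `∀ i, X i`. -/

/-- Density operators. -/
def IsDensity {n : Type} [Fintype n] (ρ : Matrix n n ℂ) : Prop :=
  ρ.PosSemidef ∧ ρ.trace = 1

/-- Quantum channels: completely positive (Kraus form) and trace preserving maps. -/
def IsChannel {n m : Type} [Fintype n] [Fintype m]
    (Φ : Matrix n n ℂ →ₗ[ℂ] Matrix m m ℂ) : Prop :=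
  (∃ (κ : Type) (_ : Fintype κ) (K : κ → Matrix m n ℂ),
      ∀ ρ, Φ ρ = ∑ k, K k * ρ * (K k).conjTranspose) ∧
    ∀ ρ, (Φ ρ).trace = ρ.trace

/-- The reduced operator on the factors in `S`: the partial trace over all other factors. -/
def reduced {ι : Type} [Fintype ι] [DecidableEq ι] {X : ι → Type} [∀ i, Fintype (X i)]
    (S : Finset ι) (ρ : Matrix (∀ i, X i) (∀ i, X i) ℂ) :
    Matrix (∀ i : {i // i ∈ S}, X i) (∀ i : {i // i ∈ S}, X i) ℂ :=
  Matrix.of fun a b => ∑ c : (∀ i : {i // i ∉ S}, X i),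
    ρ ((Equiv.piEquivPiSubtypeProd (· ∈ S) X).symm (a, c))
      ((Equiv.piEquivPiSubtypeProd (· ∈ S) X).symm (b, c))

/-- The tensor product of maps `Φ j`, the output factor `j` being itself a composite system
with factors `Y j s`; the output factors are indexed by the pairs `⟨j, s⟩`. It is determined by
its values on the matrix units `|x⟩⟨x'| = ⨂ j, |x j⟩⟨x' j|`. -/
def tensorMap {ι : Type} [Fintype ι] [DecidableEq ι] {X : ι → Type} [∀ j, Fintype (X j)]
    [∀ j, DecidableEq (X j)] {S : ι → Type} {Y : ∀ j, S j → Type}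
    (Φ : ∀ j, Matrix (X j) (X j) ℂ →ₗ[ℂ] Matrix (∀ s, Y j s) (∀ s, Y j s) ℂ) :
    Matrix (∀ j, X j) (∀ j, X j) ℂ →ₗ[ℂ]
      Matrix (∀ p : (Σ j, S j), Y p.1 p.2) (∀ p : (Σ j, S j), Y p.1 p.2) ℂ where
  toFun ρ := Matrix.of fun y y' => ∑ x, ∑ x', ρ x x' *
    ∏ j, Φ j (Matrix.single (x j) (x' j) 1) (fun s => y ⟨j, s⟩) (fun s => y' ⟨j, s⟩)
  map_add' ρ τ := by
    ext y y'
    simp [add_mul, Finset.sum_add_distrib]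
  map_smul' c ρ := by
    ext y y'
    simp [Finset.mul_sum, mul_assoc]

theorem tensorMap_apply {ι : Type} [Fintype ι] [DecidableEq ι] {X : ι → Type}
    [∀ j, Fintype (X j)] [∀ j, DecidableEq (X j)] {S : ι → Type} {Y : ∀ j, S j → Type}
    (Φ : ∀ j, Matrix (X j) (X j) ℂ →ₗ[ℂ] Matrix (∀ s, Y j s) (∀ s, Y j s) ℂ)
    (ρ : Matrix (∀ j, X j) (∀ j, X j) ℂ) (y y' : ∀ p : (Σ j, S j), Y p.1 p.2) :
    tensorMap Φ ρ y y' = ∑ x, ∑ x', ρ x x' *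
      ∏ j, Φ j (Matrix.single (x j) (x' j) 1) (fun s => y ⟨j, s⟩) (fun s => y' ⟨j, s⟩) :=
  rfl

theorem IsChannel.comp {n m l : Type} [Fintype n] [Fintype m] [Fintype l]
    {Ψ : Matrix m m ℂ →ₗ[ℂ] Matrix l l ℂ} {Φ : Matrix n n ℂ →ₗ[ℂ] Matrix m m ℂ}
    (hΨ : IsChannel Ψ) (hΦ : IsChannel Φ) : IsChannel (Ψ ∘ₗ Φ) := by
  obtain ⟨⟨κ, _, K, hK⟩, hT⟩ := hΨ
  obtain ⟨⟨κ', _, K', hK'⟩, hT'⟩ := hΦ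
  refine ⟨⟨κ × κ', inferInstance, fun k => K k.1 * K' k.2, fun ρ => ?_⟩, fun ρ => ?_⟩
  · simp [hK, hK', Fintype.sum_prod_type, Matrix.mul_sum, Matrix.sum_mul, Matrix.mul_assoc,
      Matrix.conjTranspose_mul]
  · simp [hT, hT']

theorem isChannel_tensorMap {ι : Type} [Fintype ι] [DecidableEq ι] {X : ι → Type}
    [∀ j, Fintype (X j)] [∀ j, DecidableEq (X j)] {S : ι → Type} [∀ j, Fintype (S j)]
    [∀ j, DecidableEq (S j)] {Y : ∀ j, S j → Type} [∀ j s, Fintype (Y j s)]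
    {Φ : ∀ j, Matrix (X j) (X j) ℂ →ₗ[ℂ] Matrix (∀ s, Y j s) (∀ s, Y j s) ℂ}
    (hΦ : ∀ j, IsChannel (Φ j)) : IsChannel (tensorMap Φ) := by
  constructor
  · choose κ hκ K hK using fun j => (hΦ j).1
    refine ⟨∀ j, κ j, inferInstance,
      fun k => Matrix.of fun y x => ∏ j, K j (k j) (fun s => y ⟨j, s⟩) (x j), fun ρ => ?_⟩
    ext y y'
    have h1 : ∀ (x x' : ∀ j, X j),
        ∏ j, Φ j (Matrix.single (x j) (x' j) 1) (fun s => y ⟨j, s⟩) (fun s => y' ⟨j, s⟩) =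
        ∑ k : (∀ j, κ j), ∏ j, (K j (k j) (fun s => y ⟨j, s⟩) (x j) *
          star (K j (k j) (fun s => y' ⟨j, s⟩) (x' j))) := by
      intro x x'
      rw [← Fintype.prod_sum (f := fun j k => K j k (fun s => y ⟨j, s⟩) (x j) *
        star (K j k (fun s => y' ⟨j, s⟩) (x' j)))]
      refine Finset.prod_congr rfl fun j _ => ?_
      rw [hK, Matrix.sum_apply]
      refine Finset.sum_congr rfl fun k _ => ?_
      simp [Matrix.mul_apply, Matrix.single_apply, ite_and]
    simp only [tensorMap_apply, h1, Matrix.sum_apply,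
      Matrix.mul_apply, Matrix.conjTranspose_apply, Matrix.of_apply, Finset.mul_sum,
      Finset.sum_mul, Finset.prod_mul_distrib, star_prod]
    rw [Finset.sum_comm]
    conv_lhs => enter [2, x']; rw [Finset.sum_comm]
    rw [Finset.sum_comm]
    refine Finset.sum_congr rfl fun k _ => Finset.sum_congr rfl fun x' _ =>
      Finset.sum_congr rfl fun x _ => ?_
    ring
  · intro ρ
    have h2 : ∀ (x x' : ∀ j, X j), ∑ y : (∀ p : (Σ j, S j), Y p.1 p.2),
        ∏ j, Φ j (Matrix.single (x j) (x' j) 1) (fun s => y ⟨j, s⟩) (fun s => y ⟨j, s⟩) =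
        if x = x' then 1 else 0 := by
      intro x x'
      rw [← (Equiv.piCurry (fun j s => Y j s)).symm.sum_comp]
      have h3 : ∀ z : (∀ j s, Y j s),
          ∏ j, Φ j (Matrix.single (x j) (x' j) 1)
            (fun s => (Equiv.piCurry (fun j s => Y j s)).symm z ⟨j, s⟩)
            (fun s => (Equiv.piCurry (fun j s => Y j s)).symm z ⟨j, s⟩) =
          ∏ j, Φ j (Matrix.single (x j) (x' j) 1) (z j) (z j) := fun z => rfl
      simp only [h3]
      rw [← Fintype.prod_sum
        (f := fun j z => Φ j (Matrix.single (x j) (x' j) 1) z z)]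
      have h4 : ∀ j, ∑ z, Φ j (Matrix.single (x j) (x' j) 1) z z =
          if x j = x' j then 1 else 0 := by
        intro j
        have := (hΦ j).2 (Matrix.single (x j) (x' j) 1)
        rw [Matrix.trace] at this
        simp only [Matrix.diag_apply] at this
        rw [this]
        split_ifs with h
        · rw [h]; simp
        · simp [h]
      simp only [h4]
      rw [Finset.prod_ite_zero]
      simp [funext_iff]
    simp only [Matrix.trace, Matrix.diag_apply, tensorMap_apply]
    rw [Finset.sum_comm]
    refine Finset.sum_congr rfl fun x _ => ?_
    rw [Finset.sum_comm]
    simp [← Finset.mul_sum, h2]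

/-! ### Encodings of a secret into shares -/

/-- A channel that encodes a secret system with basis `σ` into finitely many quantum shares,
the share `i` being a system with basis `Basis i`. -/
structure Encoding (σ : Type) [Fintype σ] where
  Share : Type
  [fintypeShare : Fintype Share]
  [decEqShare : DecidableEq Share]
  Basis : Share → Type
  [fintypeBasis : ∀ i, Fintype (Basis i)]
  [decEqBasis : ∀ i, DecidableEq (Basis i)]
  encode : Matrix σ σ ℂ →ₗ[ℂ] Matrix (∀ i, Basis i) (∀ i, Basis i) ℂ
  isChannel : IsChannel encode

attribute [instance] Encoding.fintypeShare Encoding.decEqShare Encoding.fintypeBasis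
  Encoding.decEqBasis

/-- The shares in `S` suffice to reconstruct every secret state. -/
def Encoding.CanRecover {σ : Type} [Fintype σ] (E : Encoding σ) (S : Finset E.Share) : Prop :=
  ∃ R : Matrix (∀ i : {i // i ∈ S}, E.Basis i) (∀ i : {i // i ∈ S}, E.Basis i) ℂ →ₗ[ℂ]
      Matrix σ σ ℂ,
    IsChannel R ∧ ∀ ρ, IsDensity ρ → R (reduced S (E.encode ρ)) = ρ

/-- The shares in `S` carry no information: their joint state does not depend on the secret. -/
def Encoding.NoInformation {σ : Type} [Fintype σ] (E : Encoding σ) (S : Finset E.Share) : Prop :=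
  ∀ ρ τ, IsDensity ρ → IsDensity τ → reduced S (E.encode ρ) = reduced S (E.encode τ)

/-- A `((k, n))` quantum threshold scheme. -/
def Encoding.IsThreshold {σ : Type} [Fintype σ] (E : Encoding σ) (k n : ℕ) : Prop :=
  Fintype.card E.Share = n ∧
    ∀ S : Finset E.Share, (k ≤ S.card → E.CanRecover S) ∧ (S.card < k → E.NoInformation S)

/-! ### Assisted schemes -/

/-- An encoding together with a distribution of its shares: `owner i = some p` if the share `i`
is given to the player `p`, and `owner i = none` if it stays with the dealer as a home share. -/
structure Scheme (σ : Type) [Fintype σ] (P : Type) extends Encoding σ where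
  owner : Share → Option P

/-- The number of home shares. -/
def Scheme.homeCount {σ : Type} [Fintype σ] {P : Type} [DecidableEq P] (𝒮 : Scheme σ P) : ℕ :=
  (Finset.univ.filter fun i => 𝒮.owner i = none).card

/-- The shares of the players in `A` together with all home shares. -/
def Scheme.available {σ : Type} [Fintype σ] {P : Type} [DecidableEq P] (𝒮 : Scheme σ P)
    (A : Finset P) : Finset 𝒮.Share :=
  Finset.univ.filter fun i => 𝒮.owner i = none ∨ ∃ p ∈ A, 𝒮.owner i = some p

/-- `𝒮` is an assisted quantum secret sharing scheme for the access structure `Γ` (the family of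
all authorized sets): not every share is a home share, and with the help of the home shares the
sets in `Γ` can reconstruct the secret while all other sets obtain no information about it. -/
def Scheme.Realizes {σ : Type} [Fintype σ] {P : Type} [DecidableEq P] (𝒮 : Scheme σ P)
    (Γ : Finset (Finset P)) : Prop :=
  𝒮.homeCount < Fintype.card 𝒮.Share ∧
    ∀ A : Finset P, (A ∈ Γ → 𝒮.CanRecover (𝒮.available A)) ∧
      (A ∉ Γ → 𝒮.NoInformation (𝒮.available A))

/-- `𝒮` is a conventional quantum secret sharing scheme for `Γ`: there are no home shares. -/
def Scheme.RealizesConventionally {σ : Type} [Fintype σ] {P : Type} [DecidableEq P]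
    (𝒮 : Scheme σ P) (Γ : Finset (Finset P)) : Prop :=
  𝒮.Realizes Γ ∧ 𝒮.homeCount = 0

/-- The scheme in which the dealer keeps the whole system as a single home share. -/
def Scheme.keep (σ : Type) [Fintype σ] [DecidableEq σ] (P : Type) : Scheme σ P where
  Share := Unit
  Basis := fun _ => σ
  encode :=
    { toFun := fun ρ => ρ.submatrix (fun x => x ()) (fun x => x ())
      map_add' := fun _ _ => rfl
      map_smul' := fun _ _ => rfl }
  isChannel := by
    refine ⟨⟨Unit, inferInstance,
      fun _ => (1 : Matrix σ σ ℂ).submatrix (fun x => x ()) id, fun ρ => ?_⟩, fun ρ => ?_⟩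
    · ext x y
      change ρ (x ()) (y ()) = _
      simp [Matrix.mul_apply, Matrix.one_apply]
    · exact Fintype.sum_equiv (Equiv.funUnique Unit σ) _ _ fun x => rfl
  owner := fun _ => none

/-- Concatenation: the secret is first encoded by `T`, then each share `j` of `T` is in turn
encoded by `Q j`, whose shares are distributed as prescribed by `Q j`. -/
def Scheme.concat {σ : Type} [Fintype σ] {P : Type} (T : Encoding σ)
    (Q : ∀ j : T.Share, Scheme (T.Basis j) P) : Scheme σ P where
  Share := Σ j, (Q j).Share
  Basis := fun p => (Q p.1).Basis p.2
  encode := tensorMap (fun j => (Q j).encode) ∘ₗ T.encode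
  isChannel := (isChannel_tensorMap fun j => (Q j).isChannel).comp T.isChannel
  owner := fun p => (Q p.1).owner p.2

/-! ### Partial link classifications -/

/-- A partition of the authorized sets into partially linked classes: any two sets in the same
class overlap, and any two distinct classes contain a pair of sets that do not. -/
def IsPartialLinkClassification {P : Type} [DecidableEq P] {Γ : Finset (Finset P)}
    (𝒞 : Finpartition Γ) : Prop :=
  (∀ C ∈ 𝒞.parts, ∀ α ∈ C, ∀ β ∈ C, (α ∩ β).Nonempty) ∧
    ∀ C ∈ 𝒞.parts, ∀ D ∈ 𝒞.parts, C ≠ D → ∃ α ∈ C, ∃ β ∈ D, ¬ (α ∩ β).Nonempty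

/-- The size `λ` of the smallest partial link classification. -/
noncomputable def linkNumber {P : Type} [DecidableEq P] (Γ : Finset (Finset P)) : ℕ :=
  sInf {n | ∃ 𝒞 : Finpartition Γ, IsPartialLinkClassification 𝒞 ∧ 𝒞.parts.card = n}

/-- The access structure generated by a class: all sets that contain a member of it. -/
def generated {P : Type} [Fintype P] [DecidableEq P] (C : Finset (Finset P)) :
    Finset (Finset P) :=
  Finset.univ.filter fun A => ∃ α ∈ C, α ⊆ A

end AQSS

namespace AQSS

/-! ### Channels given by Kraus operators and by relabelling a basis. -/

open Matrix

/-! Monotonicity is necessary because a larger set of players holds more shares: it cannot be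
ignorant of a secret that a subset of it reconstructs, since a secret of dimension at least 2 has
two different states (`Scheme.Realizes.mono`).

For the converse, everything rests on one family of codes. Let `K` be a finite additive code with a
homomorphism `L` to an abelian group of secrets, and encode the basis state `g` as the uniform
superposition of the codewords with `L = g`. Split the positions into `A` and its complement `E`. If
the word on `A` determines the secret while the zero word on `E` is compatible with every secret,
then `A` recovers coherently: it computes the secret and subtracts a representative supported on
`A`, and what is left is independent of the secret (`exists_recovery_codeState`). With the roles
exchanged, `E` learns which secret is encoded, so all coherence between secrets is lost on `A`, and
translations supported on `E` show that every secret gives the same state on `A`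
(`exists_codeState_eq_trace_smul`).

A monotone structure with pairwise intersecting members is made self-dual by one extra player, whose
share is then discarded. For a self-dual structure, additive secret sharing over each authorized set
satisfies exactly one of the two conditions above on each side of every cut. This gives conventional
schemes for all such structures (`sharing_recovers`, `sharing_hides`), over any finite abelian group
and hence in every dimension. The threshold scheme is the special case of the sets of size at least
`λ` among `2λ - 1`.

Finally, encode by that threshold scheme, re-encode one share for each class, and keep the other `λ
- 1` shares at home. An authorized set lies in some class and supplies the missing `λ`-th share; by
monotonicity an unauthorized set contains no member of any class, and the home shares alone are one
too few. The concatenation lemmas `recovers_concat` and `hides_concat` turn this count into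
statements about channels. A minimal classification exists because intersecting classes can be
merged until no further merging is possible. -/

/-- A family of Kraus operators with `∑ K†K = 1` defines a channel. -/
theorem isChannel_of_kraus {n m κ : Type} [Fintype n] [DecidableEq n] [Fintype m] [Fintype κ]
    {Φ : Matrix n n ℂ →ₗ[ℂ] Matrix m m ℂ} (K : κ → Matrix m n ℂ)
    (hΦ : ∀ ρ, Φ ρ = ∑ k, K k * ρ * (K k)ᴴ) (hK : ∑ k, (K k)ᴴ * K k = 1) : IsChannel Φ := by
  refine ⟨⟨κ, inferInstance, K, hΦ⟩, fun ρ => ?_⟩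
  rw [hΦ, trace_sum]
  have h : ∀ k, (K k * ρ * (K k)ᴴ).trace = ((K k)ᴴ * K k * ρ).trace := fun k => by
    rw [trace_mul_comm, Matrix.mul_assoc]
  simp only [h]
  rw [← trace_sum, ← Matrix.sum_mul, hK, Matrix.one_mul]

/-- Relabel the basis by `φ` and discard the second factor. -/
def relabel {n m k : Type} [Fintype n] [Fintype k] [DecidableEq m] [DecidableEq k]
    (φ : n → m × k) : Matrix n n ℂ →ₗ[ℂ] Matrix m m ℂ where
  toFun τ := Matrix.of fun s s' => ∑ y, ∑ a, ∑ a',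
    if φ a = (s, y) ∧ φ a' = (s', y) then τ a a' else 0
  map_add' τ υ := by
    ext s s'
    simp only [of_apply, Matrix.add_apply, ← Finset.sum_add_distrib]
    refine Finset.sum_congr rfl fun y _ => Finset.sum_congr rfl fun a _ =>
      Finset.sum_congr rfl fun a' _ => ?_
    split_ifs <;> simp
  map_smul' c τ := by
    ext s s'
    simp [Finset.mul_sum]

theorem relabel_apply {n m k : Type} [Fintype n] [Fintype k] [DecidableEq m] [DecidableEq k]
    (φ : n → m × k) (τ : Matrix n n ℂ) (s s' : m) :
    relabel φ τ s s' = ∑ y, ∑ a, ∑ a',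
      if φ a = (s, y) ∧ φ a' = (s', y) then τ a a' else 0 := rfl

/-- An injective relabelling is an isometry into the product, and tracing out the second factor
gives one Kraus operator for each of its labels. -/
theorem isChannel_relabel {n m k : Type} [Fintype n] [Fintype m] [Fintype k]
    [DecidableEq m] [DecidableEq k] {φ : n → m × k} (hφ : Function.Injective φ) :
    IsChannel (relabel φ) := by
  classical
  refine isChannel_of_kraus
    (fun y => Matrix.of fun s a => if φ a = (s, y) then (1 : ℂ) else 0) (fun τ => ?_) ?_
  · ext s s'
    simp only [relabel_apply, Matrix.sum_apply, Matrix.mul_apply, conjTranspose_apply, of_apply,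
      Finset.sum_mul]
    refine Finset.sum_congr rfl fun y _ => ?_
    rw [Finset.sum_comm]
    refine Finset.sum_congr rfl fun a' _ => Finset.sum_congr rfl fun a _ => ?_
    split_ifs <;> simp_all
  · ext a a'
    simp only [Matrix.sum_apply, Matrix.mul_apply, conjTranspose_apply, of_apply]
    rw [Finset.sum_comm, ← Fintype.sum_prod_type'
      (f := fun s y => star (if φ a = (s, y) then (1 : ℂ) else 0) *
        if φ a' = (s, y) then (1 : ℂ) else 0)]
    simp [Matrix.one_apply, hφ.eq_iff, apply_ite, eq_comm]

/-- For a relabelling by a bijection the sums over preimages collapse. -/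
theorem relabel_equiv_apply {n m k : Type} [Fintype n] [Fintype k]
    [DecidableEq m] [DecidableEq k] (φ : n ≃ m × k) (τ : Matrix n n ℂ) (s s' : m) :
    relabel φ τ s s' = ∑ y, τ (φ.symm (s, y)) (φ.symm (s', y)) := by
  classical
  rw [relabel_apply]
  refine Finset.sum_congr rfl fun y _ => ?_
  simp [ite_and, ← Equiv.eq_symm_apply]

/-! ### Encodings from additive codes -/

section Code

variable {A E W σ : Type} [Fintype E] [Fintype W]
  [AddCommGroup A] [AddCommGroup E] [AddCommGroup W] [AddCommGroup σ]

theorem sum_sum_addEquiv [Fintype A] (ψ : A × E ≃+ W) (f : W → ℂ) :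
    ∑ a, ∑ e, f (ψ (a, e)) = ∑ w, f w := by
  rw [← Fintype.sum_prod_type' (f := fun a e => f (ψ (a, e)))]
  exact Fintype.sum_equiv ψ.toEquiv _ _ fun _ => rfl

open Classical in
/-- The number of codewords of `K` that carry the secret `g` under `L`. -/
noncomputable def fiberSize (K : AddSubgroup W) (L : W →+ σ) (g : σ) : ℂ :=
  ∑ w, if w ∈ K ∧ L w = g then 1 else 0

theorem fiberSize_zero_ne_zero (K : AddSubgroup W) (L : W →+ σ) : fiberSize K L 0 ≠ 0 := by
  classical
  unfold fiberSize
  rw [Finset.sum_boole]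
  have : (Finset.univ.filter fun w => w ∈ K ∧ L w = 0).Nonempty :=
    ⟨0, by simp [K.zero_mem]⟩
  exact_mod_cast this.card_pos.ne'

/-- Translation by a codeword with secret `g` maps the fibre over `0` bijectively onto the fibre
over `g`; hence one normalization serves all secrets. -/
theorem fiberSize_eq {K : AddSubgroup W} {L : W →+ σ} {g : σ} {k : W} (hk : k ∈ K)
    (hg : L k = g) : fiberSize K L g = fiberSize K L 0 := by
  classical
  unfold fiberSize
  refine (Fintype.sum_equiv (Equiv.addRight k) _ _ fun w => ?_).symm
  simp [K.add_mem_cancel_right hk, hg]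

open Classical in
/-- The state on `A` of the uniform superposition of all codewords, the secret being `ρ`, where
the codewords are distributed among `A` and an environment `E`. -/
noncomputable def codeState (ψ : A × E ≃+ W) (K : AddSubgroup W) (L : W →+ σ) :
    Matrix σ σ ℂ →ₗ[ℂ] Matrix A A ℂ where
  toFun ρ := Matrix.of fun a b => (fiberSize K L 0)⁻¹ *
    ∑ e, if ψ (a, e) ∈ K ∧ ψ (b, e) ∈ K then ρ (L (ψ (a, e))) (L (ψ (b, e))) else 0
  map_add' ρ τ := by
    ext a b
    simp only [of_apply, Matrix.add_apply, ← mul_add, ← Finset.sum_add_distrib]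
    congr 1
    refine Finset.sum_congr rfl fun e _ => ?_
    split_ifs <;> simp
  map_smul' c ρ := by
    ext a b
    simp only [of_apply, Matrix.smul_apply, smul_eq_mul, RingHom.id_apply, Finset.mul_sum,
      mul_ite, mul_zero]
    refine Finset.sum_congr rfl fun e _ => ?_
    split_ifs <;> ring

open Classical in
theorem codeState_apply (ψ : A × E ≃+ W) (K : AddSubgroup W) (L : W →+ σ) (ρ : Matrix σ σ ℂ)
    (a b : A) : codeState ψ K L ρ a b = (fiberSize K L 0)⁻¹ *
    ∑ e, if ψ (a, e) ∈ K ∧ ψ (b, e) ∈ K then ρ (L (ψ (a, e))) (L (ψ (b, e))) else 0 := rfl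

/-- The underlying map is an isometry: superpositions over different fibres are orthogonal and all
fibres have the same size. Tracing out `E` yields one Kraus operator for each `e`. -/
theorem isChannel_codeState [Fintype A] [Fintype σ] (ψ : A × E ≃+ W)
    {K : AddSubgroup W} {L : W →+ σ}
    (hL : ∀ g, ∃ k ∈ K, L k = g) : IsChannel (codeState ψ K L) := by
  classical
  have hM : ∃ c : ℂ, c * star c = (fiberSize K L 0)⁻¹ := by
    -- The amplitude of one codeword in a uniform superposition over a fibre.
    refine ⟨((Real.sqrt (Finset.univ.filter fun w => w ∈ K ∧ L w = 0).card)⁻¹ : ℝ), ?_⟩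
    rw [Complex.star_def, Complex.conj_ofReal, ← Complex.ofReal_mul, ← mul_inv,
      Real.mul_self_sqrt (by positivity), fiberSize, Finset.sum_boole]
    push_cast
    rfl
  obtain ⟨c, hc⟩ := hM
  refine isChannel_of_kraus (fun e => Matrix.of fun a s =>
    if ψ (a, e) ∈ K ∧ L (ψ (a, e)) = s then c else 0) (fun ρ => ?_) ?_
  · ext a b
    simp only [codeState_apply, Matrix.sum_apply, Matrix.mul_apply, conjTranspose_apply,
      of_apply, Finset.mul_sum, Finset.sum_mul, ← hc]
    refine Finset.sum_congr rfl fun e _ => ?_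
    by_cases ha : ψ (a, e) ∈ K <;> by_cases hb : ψ (b, e) ∈ K <;>
      simp [ha, hb, apply_ite star, ite_mul, mul_ite]
    ring
  · ext s s'
    simp only [Matrix.sum_apply, Matrix.mul_apply, conjTranspose_apply, of_apply]
    rw [Finset.sum_comm, sum_sum_addEquiv ψ (fun w => star (if w ∈ K ∧ L w = s then c else 0) *
        (if w ∈ K ∧ L w = s' then c else 0))]
    obtain ⟨k, hk, hks⟩ := hL s
    have h1 : ∀ w, star (if w ∈ K ∧ L w = s then c else 0) *
        (if w ∈ K ∧ L w = s' then c else 0) =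
        (if s = s' then (fiberSize K L 0)⁻¹ else 0) * if w ∈ K ∧ L w = s then 1 else 0 := by
      intro w
      by_cases hw : w ∈ K ∧ L w = s
      · obtain ⟨hw, rfl⟩ := hw
        by_cases h : L w = s' <;> simp [hw, h, ← hc, mul_comm]
      · simp [hw]
    simp only [h1, ← Finset.mul_sum]
    change _ * fiberSize K L s = _
    rw [fiberSize_eq hk hks, Matrix.one_apply]
    split_ifs
    · exact inv_mul_cancel₀ (fiberSize_zero_ne_zero K L)
    · simp

/-- If `A` determines the secret and `E` is compatible with every secret, then `A` can
reconstruct the secret coherently. -/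
theorem exists_recovery_codeState [Fintype A] [Fintype σ] (ψ : A × E ≃+ W)
    {K : AddSubgroup W} {L : W →+ σ}
    (hdet : ∀ e, ψ (0, e) ∈ K → L (ψ (0, e)) = 0)
    (hfree : ∀ g, ∃ a, ψ (a, 0) ∈ K ∧ L (ψ (a, 0)) = g) :
    ∃ R : Matrix A A ℂ →ₗ[ℂ] Matrix σ σ ℂ, IsChannel R ∧ ∀ ρ, R (codeState ψ K L ρ) = ρ := by
  classical
  choose w hwK hwL using hfree
  -- Two completions of the same `a` differ by a codeword that vanishes on `A`, whose secret is `0`.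
  have hdet' : ∀ a e e', ψ (a, e) ∈ K → ψ (a, e') ∈ K → L (ψ (a, e)) = L (ψ (a, e')) := by
    intro a e e' h h'
    have hs : ψ (0, e - e') = ψ (a, e) - ψ (a, e') := by
      rw [← map_sub]; simp
    have := hdet (e - e') (hs ▸ K.sub_mem h h')
    rwa [hs, map_sub, sub_eq_zero] at this
  -- Words without a completion never occur in the encoded state; the value `0` only makes the
  -- decoder total.
  let dec : A → σ := fun a => if h : ∃ e, ψ (a, e) ∈ K then L (ψ (a, h.choose)) else 0
  have hdec : ∀ a e, ψ (a, e) ∈ K → dec a = L (ψ (a, e)) := by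
    intro a e h
    have hex : ∃ e, ψ (a, e) ∈ K := ⟨e, h⟩
    simp only [dec, dif_pos hex]
    exact hdet' _ _ _ hex.choose_spec h
  -- The remainder `a - w (dec a)` together with `dec a` gives back `a`, so the decoding is a
  -- reversible relabelling.
  have hφ : Function.Injective fun a => (dec a, a - w (dec a)) := by
    intro a b h
    obtain ⟨h1, h2⟩ := Prod.mk.inj h
    rw [h1] at h2
    exact sub_left_injective h2
  refine ⟨relabel fun a => (dec a, a - w (dec a)), isChannel_relabel hφ, fun ρ => ?_⟩
  have hshift : ∀ y g e, ψ (y + w g, e) = ψ (y, e) + ψ (w g, 0) := by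
    intro y g e
    rw [← map_add]; simp
  ext s s'
  have hcond : ∀ (a : A) (s : σ) (y : A), ((dec a, a - w (dec a)) = (s, y)) ↔
      (a = y + w s ∧ dec (y + w s) = s) := by
    intro a s y
    rw [Prod.mk.injEq]
    constructor
    · rintro ⟨rfl, rfl⟩
      simp
    · rintro ⟨rfl, h⟩
      simp [h]
  have hsum : ∀ y, (∑ a, ∑ a', if (dec a, a - w (dec a)) = (s, y) ∧
      (dec a', a' - w (dec a')) = (s', y) then codeState ψ K L ρ a a' else 0) =
      ((fiberSize K L 0)⁻¹ * ρ s s') *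
        ∑ e, if ψ (y, e) ∈ K ∧ L (ψ (y, e)) = 0 then 1 else 0 := by
    intro y
    -- If `(y, e)` is a codeword, then so is each `(y + w g, e)`, and it decodes to `L (ψ (y, e)) +
    -- g`; otherwise none of them is. Both decoding tests thus become `L (ψ (y, e)) = 0`, and the
    -- remainder no longer depends on `s` and `s'`.
    have hterm : ∀ e, (if dec (y + w s) = s then if dec (y + w s') = s' then
        (if ψ (y + w s, e) ∈ K ∧ ψ (y + w s', e) ∈ K then
          ρ (L (ψ (y + w s, e))) (L (ψ (y + w s', e))) else 0) else 0 else 0) =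
        ρ s s' * if ψ (y, e) ∈ K ∧ L (ψ (y, e)) = 0 then 1 else 0 := by
      intro e
      by_cases hy : ψ (y, e) ∈ K
      · have h1 : ∀ g, ψ (y + w g, e) ∈ K := fun g => by
          rw [hshift]; exact K.add_mem hy (hwK g)
        have h2 : ∀ g, L (ψ (y + w g, e)) = L (ψ (y, e)) + g := fun g => by
          rw [hshift, map_add, hwL]
        have h3 : ∀ g, dec (y + w g) = L (ψ (y, e)) + g := fun g => by
          rw [hdec _ _ (h1 g), h2]
        by_cases h0 : L (ψ (y, e)) = 0 <;> simp [hy, h1, h2, h3, h0]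
      · have h1 : ∀ g, ψ (y + w g, e) ∉ K := fun g => by
          rw [hshift]; rwa [K.add_mem_cancel_right (hwK g)]
        simp [hy, h1]
    rw [mul_assoc, Finset.mul_sum, ← Finset.sum_congr rfl fun e _ => hterm e]
    simp only [hcond, ite_and, Finset.sum_ite_eq', Finset.mem_univ, if_true,
      Finset.sum_ite_irrel, Finset.sum_const_zero, codeState_apply]
    by_cases h1 : dec (y + w s) = s <;> by_cases h2 : dec (y + w s') = s' <;> simp [h1, h2]
  rw [relabel_apply]
  simp only [hsum, ← Finset.mul_sum]
  rw [sum_sum_addEquiv ψ (fun w => if w ∈ K ∧ L w = 0 then (1 : ℂ) else 0)]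
  change _ * fiberSize K L 0 = _
  have := fiberSize_zero_ne_zero K L
  field_simp

/-- If `E` determines the secret and `A` is compatible with every secret, then the state of `A`
does not depend on the secret. -/
theorem exists_codeState_eq_trace_smul [Fintype σ] (ψ : A × E ≃+ W)
    {K : AddSubgroup W} {L : W →+ σ}
    (hdet : ∀ a, ψ (a, 0) ∈ K → L (ψ (a, 0)) = 0)
    (hfree : ∀ g, ∃ e, ψ (0, e) ∈ K ∧ L (ψ (0, e)) = g) :
    ∃ ω : Matrix A A ℂ, ∀ ρ, codeState ψ K L ρ = ρ.trace • ω := by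
  classical
  choose w hwK hwL using hfree
  refine ⟨Matrix.of fun a b => (fiberSize K L 0)⁻¹ *
    ∑ e, if ψ (a, e) ∈ K ∧ ψ (b, e) ∈ K ∧ L (ψ (a, e)) = 0 then 1 else 0, fun ρ => ?_⟩
  ext a b
  have hshift : ∀ a g e, ψ (a, e + w g) = ψ (a, e) + ψ (0, w g) := by
    intro a g e
    rw [← map_add]; simp
  -- Translating the environment by `w g` carries secret `0` to secret `g` without touching `a` or
  -- `b`.
  have hF : ∀ g, (∑ e, if ψ (a, e) ∈ K ∧ ψ (b, e) ∈ K ∧ L (ψ (a, e)) = g then (1 : ℂ) else 0) =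
      ∑ e, if ψ (a, e) ∈ K ∧ ψ (b, e) ∈ K ∧ L (ψ (a, e)) = 0 then 1 else 0 := by
    intro g
    refine (Fintype.sum_equiv (Equiv.addRight (w g)) _ _ fun e => ?_).symm
    simp [hshift, K.add_mem_cancel_right (hwK g), hwL]
  -- Codewords `(a, e)` and `(b, e)` differ by one that vanishes on `E`, so they carry the same
  -- secret: only diagonal entries of `ρ` survive.
  have hterm : ∀ e, (if ψ (a, e) ∈ K ∧ ψ (b, e) ∈ K then
      ρ (L (ψ (a, e))) (L (ψ (b, e))) else 0) =
      ∑ g, ρ g g * if ψ (a, e) ∈ K ∧ ψ (b, e) ∈ K ∧ L (ψ (a, e)) = g then 1 else 0 := by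
    intro e
    by_cases h : ψ (a, e) ∈ K ∧ ψ (b, e) ∈ K
    · have hs : ψ (a - b, 0) = ψ (a, e) - ψ (b, e) := by
        rw [← map_sub]; simp
      have := hdet (a - b) (hs ▸ K.sub_mem h.1 h.2)
      rw [hs, map_sub, sub_eq_zero] at this
      simp [h.1, h.2, this]
    · rw [if_neg h]
      refine (Finset.sum_eq_zero fun g _ => ?_).symm
      rw [if_neg fun h' => h ⟨h'.1, h'.2.1⟩, mul_zero]
  simp only [codeState_apply, hterm, Matrix.smul_apply, of_apply, smul_eq_mul]
  rw [Finset.sum_comm]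
  simp only [← Finset.mul_sum, hF, ← Finset.sum_mul, Matrix.trace, Matrix.diag_apply]
  ring

end Code

/-! ### Channels that relabel or discard factors -/

theorem relabel_unit_apply {n m : Type} [Fintype n] [DecidableEq m] (e : n ≃ m)
    (τ : Matrix n n ℂ) (s s' : m) :
    relabel (fun a => (e a, ())) τ s s' = τ (e.symm s) (e.symm s') := by
  classical
  rw [relabel_apply]
  simp [ite_and, ← Equiv.eq_symm_apply]

theorem isChannel_relabel_unit {n m : Type} [Fintype n] [Fintype m] [DecidableEq m] (e : n ≃ m) :
    IsChannel (relabel fun a => (e a, ())) :=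
  isChannel_relabel fun _ _ h => e.injective (Prod.mk.inj h).1

section Reduced

variable {ι : Type} [Fintype ι] [DecidableEq ι] {X : ι → Type} [∀ i, Fintype (X i)]
  [∀ i, DecidableEq (X i)]

/-- `reduced S` as a linear map. -/
def reducedMap (S : Finset ι) : Matrix (∀ i, X i) (∀ i, X i) ℂ →ₗ[ℂ]
    Matrix (∀ i : {i // i ∈ S}, X i) (∀ i : {i // i ∈ S}, X i) ℂ :=
  relabel (Equiv.piEquivPiSubtypeProd (· ∈ S) X)

theorem reducedMap_apply (S : Finset ι) (τ : Matrix (∀ i, X i) (∀ i, X i) ℂ) :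
    reducedMap S τ = reduced S τ := by
  ext a b
  exact relabel_equiv_apply _ _ _ _

theorem isChannel_reducedMap (S : Finset ι) : IsChannel (reducedMap (X := X) S) :=
  isChannel_relabel (Equiv.injective _)

theorem trace_reduced (S : Finset ι) (τ : Matrix (∀ i, X i) (∀ i, X i) ℂ) :
    (reduced S τ).trace = τ.trace := by
  rw [← reducedMap_apply, (isChannel_reducedMap S).2]

end Reduced

/-- The channel that discards its input and prepares the basis state `x`. -/
theorem exists_isChannel_const {n m : Type} [Fintype n] [Fintype m] [DecidableEq n]
    [DecidableEq m] (x : m) : ∃ D : Matrix n n ℂ →ₗ[ℂ] Matrix m m ℂ, IsChannel D ∧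
      ∀ τ, D τ = τ.trace • Matrix.single x x 1 := by
  refine ⟨relabel fun a => (x, a), isChannel_relabel fun a b h => (Prod.mk.inj h).2,
    fun τ => ?_⟩
  ext s s'
  rw [relabel_apply]
  by_cases h : x = s <;> by_cases h' : x = s' <;>
    simp [h, h', Matrix.trace, Matrix.single_apply, ite_and]

/-! ### Tensor products of maps between simple factors -/

section PiMap

variable {ι : Type} [Fintype ι] [DecidableEq ι] {X Y : ι → Type} [∀ j, Fintype (X j)]
  [∀ j, DecidableEq (X j)] [∀ j, Fintype (Y j)] [∀ j, DecidableEq (Y j)]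

/-- The tensor product of the maps `Φ j`. -/
def piMap (Φ : ∀ j, Matrix (X j) (X j) ℂ →ₗ[ℂ] Matrix (Y j) (Y j) ℂ) :
    Matrix (∀ j, X j) (∀ j, X j) ℂ →ₗ[ℂ] Matrix (∀ j, Y j) (∀ j, Y j) ℂ where
  toFun τ := Matrix.of fun y y' => ∑ x, ∑ x', τ x x' *
    ∏ j, Φ j (Matrix.single (x j) (x' j) 1) (y j) (y' j)
  map_add' ρ τ := by
    ext y y'
    simp [add_mul, Finset.sum_add_distrib]
  map_smul' c ρ := by
    ext y y'
    simp [Finset.mul_sum, mul_assoc]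

omit [∀ j, Fintype (Y j)] [∀ j, DecidableEq (Y j)] in
theorem piMap_apply (Φ : ∀ j, Matrix (X j) (X j) ℂ →ₗ[ℂ] Matrix (Y j) (Y j) ℂ)
    (τ : Matrix (∀ j, X j) (∀ j, X j) ℂ) (y y' : ∀ j, Y j) :
    piMap Φ τ y y' = ∑ x, ∑ x', τ x x' *
      ∏ j, Φ j (Matrix.single (x j) (x' j) 1) (y j) (y' j) := rfl

/-- Each output is regarded as a composite system with a single factor, which reduces the claim to
`isChannel_tensorMap`. -/
theorem isChannel_piMap {Φ : ∀ j, Matrix (X j) (X j) ℂ →ₗ[ℂ] Matrix (Y j) (Y j) ℂ}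
    (hΦ : ∀ j, IsChannel (Φ j)) : IsChannel (piMap Φ) := by
  let e : (∀ p : (Σ _ : ι, Unit), Y p.1) ≃ ∀ j, Y j :=
    ⟨fun y j => y ⟨j, ()⟩, fun y p => y p.1, fun _ => rfl, fun _ => rfl⟩
  have h := (isChannel_relabel_unit e).comp (isChannel_tensorMap (S := fun _ => Unit)
    (Y := fun j _ => Y j) fun j =>
      (isChannel_relabel_unit (Equiv.funUnique Unit (Y j)).symm).comp (hΦ j))
  convert h
  ext1 τ
  ext y y'
  rw [LinearMap.comp_apply, relabel_unit_apply, tensorMap_apply, piMap_apply]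
  simp only [LinearMap.comp_apply, relabel_unit_apply]
  rfl

theorem map_eq_sum_single {n m : Type} [Fintype n] [DecidableEq n]
    (D : Matrix n n ℂ →ₗ[ℂ] Matrix m m ℂ) (τ : Matrix n n ℂ) (z z' : m) :
    D τ z z' = ∑ y, ∑ y', τ y y' * D (Matrix.single y y' 1) z z' := by
  conv_lhs => rw [Matrix.matrix_eq_sum_single τ]
  simp only [map_sum, Matrix.sum_apply]
  refine Finset.sum_congr rfl fun y _ => Finset.sum_congr rfl fun y' _ => ?_
  have : Matrix.single y y' (τ y y') = τ y y' • Matrix.single y y' (1 : ℂ) := by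
    simp [Matrix.smul_single]
  rw [this, map_smul, Matrix.smul_apply, smul_eq_mul]

theorem piMap_piMap {Z : ι → Type} (D : ∀ j, Matrix (Y j) (Y j) ℂ →ₗ[ℂ] Matrix (Z j) (Z j) ℂ)
    (Φ : ∀ j, Matrix (X j) (X j) ℂ →ₗ[ℂ] Matrix (Y j) (Y j) ℂ)
    (τ : Matrix (∀ j, X j) (∀ j, X j) ℂ) :
    piMap D (piMap Φ τ) = piMap (fun j => D j ∘ₗ Φ j) τ := by
  ext z z'
  have h : ∀ x x' : ∀ j, X j,
      ∏ j, (D j ∘ₗ Φ j) (Matrix.single (x j) (x' j) 1) (z j) (z' j) =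
      ∑ y : ∀ j, Y j, ∑ y' : ∀ j, Y j,
        (∏ j, Φ j (Matrix.single (x j) (x' j) 1) (y j) (y' j)) *
        ∏ j, D j (Matrix.single (y j) (y' j) 1) (z j) (z' j) := by
    intro x x'
    simp only [LinearMap.comp_apply]
    simp_rw [map_eq_sum_single (D _) (Φ _ _), ← Finset.prod_mul_distrib]
    rw [Fintype.prod_sum]
    refine Finset.sum_congr rfl fun y _ => ?_
    rw [Fintype.prod_sum]
  simp only [piMap_apply, h, Finset.sum_mul, Finset.mul_sum]
  calc _ = ∑ y : ∀ j, Y j, ∑ x : ∀ j, X j, ∑ x' : ∀ j, X j, ∑ y' : ∀ j, Y j, _ := by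
        refine Finset.sum_congr rfl fun y _ => ?_
        rw [Finset.sum_comm]
        refine Finset.sum_congr rfl fun x _ => ?_
        rw [Finset.sum_comm]
    _ = _ := by
        rw [Finset.sum_comm]
        refine Finset.sum_congr rfl fun x _ => ?_
        rw [Finset.sum_comm]
        refine Finset.sum_congr rfl fun x' _ => Finset.sum_congr rfl fun y _ =>
          Finset.sum_congr rfl fun y' _ => ?_
        ring

/-- Gluing basis labels of the factors in `J` and of the other factors. -/
abbrev glue (J : Finset ι) (u : ∀ j : {j // j ∈ J}, X j) (v : ∀ j : {j // j ∉ J}, X j) :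
    ∀ j, X j :=
  (Equiv.piEquivPiSubtypeProd (· ∈ J) X).symm (u, v)

omit [Fintype ι] [∀ j, Fintype (X j)] [∀ j, DecidableEq (X j)] in
theorem glue_mem {J : Finset ι} (u : ∀ j : {j // j ∈ J}, X j) (v : ∀ j : {j // j ∉ J}, X j)
    (j : {j // j ∈ J}) : glue J u v j = u j := by
  simp [glue, Equiv.piEquivPiSubtypeProd]

omit [Fintype ι] [∀ j, Fintype (X j)] [∀ j, DecidableEq (X j)] in
theorem glue_not_mem {J : Finset ι} (u : ∀ j : {j // j ∈ J}, X j) (v : ∀ j : {j // j ∉ J}, X j)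
    (j : {j // j ∉ J}) : glue J u v j = v j := by
  simp [glue, Equiv.piEquivPiSubtypeProd, j.2]

omit [∀ j, DecidableEq (X j)] in
theorem sum_glue (J : Finset ι) (f : (∀ j, X j) → ℂ) :
    ∑ x, f x = ∑ u : (∀ j : {j // j ∈ J}, X j), ∑ v : (∀ j : {j // j ∉ J}, X j),
      f (glue J u v) := by
  rw [← Fintype.sum_prod_type' (f := fun u v => f (glue J u v))]
  exact (Fintype.sum_equiv (Equiv.piEquivPiSubtypeProd (· ∈ J) X).symm _ _ fun _ => rfl).symm

theorem prod_eq_prod_mem_mul_prod_notMem {ι : Type} [Fintype ι] [DecidableEq ι] (J : Finset ι)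
    (f : ι → ℂ) :
    ∏ j, f j = (∏ j : {j // j ∈ J}, f j) * ∏ j : {j // j ∉ J}, f j := by
  rw [← Fintype.prod_subtype_mul_prod_subtype (· ∈ J)]
  congr!

omit [∀ j, Fintype (Y j)] [∀ j, DecidableEq (Y j)] in
/-- If the factors outside `J` forget their input, a tensor product of maps depends only on the
reduced operator on `J`. -/
theorem piMap_apply_of_forget (J : Finset ι)
    (Θ : ∀ j, Matrix (X j) (X j) ℂ →ₗ[ℂ] Matrix (Y j) (Y j) ℂ)
    (ω : ∀ j : {j // j ∉ J}, Matrix (Y j) (Y j) ℂ)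
    (hΘ : ∀ (j : {j // j ∉ J}) τ, Θ j τ = τ.trace • ω j)
    (τ : Matrix (∀ j, X j) (∀ j, X j) ℂ) (y y' : ∀ j, Y j) :
    piMap Θ τ y y' = ∑ u : (∀ j : {j // j ∈ J}, X j), ∑ u' : (∀ j : {j // j ∈ J}, X j),
      reduced J τ u u' * ((∏ j : {j // j ∈ J}, Θ j (Matrix.single (u j) (u' j) 1) (y j) (y' j)) *
        ∏ j : {j // j ∉ J}, ω j (y j) (y' j)) := by
  -- A forgetful factor sees only the trace of `|v j⟩⟨v' j|`, which vanishes off the diagonal;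
  -- summing over `v = v'` is the partial trace.
  have hprod : ∀ (u u' : ∀ j : {j // j ∈ J}, X j) (v v' : ∀ j : {j // j ∉ J}, X j),
      ∏ j, Θ j (Matrix.single (glue J u v j) (glue J u' v' j) 1) (y j) (y' j) =
      if v = v' then (∏ j : {j // j ∈ J}, Θ j (Matrix.single (u j) (u' j) 1) (y j) (y' j)) *
        ∏ j : {j // j ∉ J}, ω j (y j) (y' j) else 0 := by
    intro u u' v v'
    rw [prod_eq_prod_mem_mul_prod_notMem J]
    simp only [glue_mem, glue_not_mem, hΘ, Matrix.smul_apply, smul_eq_mul]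
    split_ifs with h
    · simp only [h, Matrix.trace_single_eq_same, one_mul]
    · obtain ⟨j, hj⟩ := Function.ne_iff.mp h
      rw [Finset.prod_eq_zero (i := j) (s := (Finset.univ : Finset {j // j ∉ J}))
        (Finset.mem_univ _) (by simp [hj]), mul_zero]
  rw [piMap_apply, sum_glue J]
  refine Finset.sum_congr rfl fun u _ => ?_
  simp only [sum_glue J (fun x' => _ * _), hprod]
  rw [Finset.sum_comm]
  refine Finset.sum_congr rfl fun u' _ => ?_
  simp only [mul_ite, mul_zero, Finset.sum_ite_eq, Finset.mem_univ, if_true, reduced,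
    of_apply, Finset.sum_mul]

/-- A tensor product of maps that is the identity on `J` and prepares fixed states outside `J`
does not change the reduced operator on `J`. -/
theorem reduced_piMap (J : Finset ι) (Θ : ∀ j, Matrix (X j) (X j) ℂ →ₗ[ℂ] Matrix (X j) (X j) ℂ)
    (ω : ∀ j : {j // j ∉ J}, Matrix (X j) (X j) ℂ) (hω : ∀ j, (ω j).trace = 1)
    (hΘ : ∀ (j : {j // j ∉ J}) τ, Θ j τ = τ.trace • ω j) (hid : ∀ j ∈ J, ∀ τ, Θ j τ = τ)
    (τ : Matrix (∀ j, X j) (∀ j, X j) ℂ) : reduced J (piMap Θ τ) = reduced J τ := by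
  ext a b
  have hω' : ∑ c : (∀ j : {j // j ∉ J}, X j), ∏ j, ω j (c j) (c j) = 1 := by
    rw [← Fintype.prod_sum (f := fun j c => ω j c c)]
    exact Finset.prod_eq_one fun j _ => hω j
  have hJ : ∀ u u' : (∀ j : {j // j ∈ J}, X j),
      ∏ j : {j // j ∈ J}, Θ j (Matrix.single (u j) (u' j) 1) (a j) (b j) =
        if u = a ∧ u' = b then 1 else 0 := by
    intro u u'
    simp only [fun j : {j // j ∈ J} => hid j j.2, Matrix.single_apply]
    rw [Finset.prod_ite_zero]
    simp [funext_iff, forall_and]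
  have hc : ∀ c, piMap Θ τ (glue J a c) (glue J b c) =
      reduced J τ a b * ∏ j : {j // j ∉ J}, ω j (c j) (c j) := by
    intro c
    simp only [piMap_apply_of_forget J Θ ω hΘ, glue_mem, glue_not_mem, hJ]
    rw [Finset.sum_eq_single a, Finset.sum_eq_single b] <;> simp +contextual
  change ∑ c, piMap Θ τ (glue J a c) (glue J b c) = _
  simp only [hc, ← Finset.mul_sum, hω', mul_one]

end PiMap

/-! ### Reconstruction and secrecy on all operators -/

/-- Recovery of every operator, not only of every state. -/
def Encoding.Recovers {σ : Type} [Fintype σ] (E : Encoding σ) (S : Finset E.Share) : Prop :=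
  ∃ R : Matrix (∀ i : {i // i ∈ S}, E.Basis i) (∀ i : {i // i ∈ S}, E.Basis i) ℂ →ₗ[ℂ]
      Matrix σ σ ℂ,
    IsChannel R ∧ ∀ ρ, R (reduced S (E.encode ρ)) = ρ

/-- The reduced operator depends on the secret operator only through its trace. -/
def Encoding.Hides {σ : Type} [Fintype σ] (E : Encoding σ) (S : Finset E.Share) : Prop :=
  ∃ ω, ∀ ρ, reduced S (E.encode ρ) = ρ.trace • ω

theorem Encoding.Recovers.canRecover {σ : Type} [Fintype σ] {E : Encoding σ} {S : Finset E.Share}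
    (h : E.Recovers S) : E.CanRecover S := by
  obtain ⟨R, hR, h⟩ := h
  exact ⟨R, hR, fun ρ _ => h ρ⟩

theorem Encoding.Hides.noInformation {σ : Type} [Fintype σ] {E : Encoding σ}
    {S : Finset E.Share} (h : E.Hides S) : E.NoInformation S := by
  obtain ⟨ω, h⟩ := h
  intro ρ τ hρ hτ
  rw [h, h, hρ.2, hτ.2]

/-! ### Concatenation -/

section Concat

/-- Labels of the factors `⟨j, s⟩` with `s ∈ V j`, curried. -/
def sigmaLabels {ι : Type} [Fintype ι] {S : ι → Type} {Y : ∀ j, S j → Type}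
    (V : ∀ j, Finset (S j)) :
    (∀ p : {p : Σ j, S j // p ∈ Finset.univ.sigma V}, Y p.1.1 p.1.2) ≃
      ∀ j, ∀ s : {s // s ∈ V j}, Y j s where
  toFun a j s := a ⟨⟨j, s⟩, by simp⟩
  invFun y p := y p.1.1 ⟨p.1.2, (Finset.mem_sigma.mp p.2).2⟩
  left_inv _ := rfl
  right_inv _ := rfl

/-- Labels of the factors `⟨j, s⟩` with `s ∉ V j`, curried. -/
def sigmaLabelsCompl {ι : Type} [Fintype ι] {S : ι → Type} {Y : ∀ j, S j → Type}
    (V : ∀ j, Finset (S j)) :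
    (∀ p : {p : Σ j, S j // p ∉ Finset.univ.sigma V}, Y p.1.1 p.1.2) ≃
      ∀ j, ∀ s : {s // s ∉ V j}, Y j s where
  toFun a j s := a ⟨⟨j, s⟩, by simp [s.2]⟩
  invFun y p := y p.1.1 ⟨p.1.2, fun h => p.2 (Finset.mem_sigma.mpr ⟨Finset.mem_univ _, h⟩)⟩
  left_inv _ := rfl
  right_inv _ := rfl

variable {ι : Type} [Fintype ι] [DecidableEq ι] {X : ι → Type} [∀ j, Fintype (X j)]
    [∀ j, DecidableEq (X j)] {S : ι → Type} [∀ j, Fintype (S j)]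
    [∀ j, DecidableEq (S j)] {Y : ∀ j, S j → Type} [∀ j s, Fintype (Y j s)]
    [∀ j s, DecidableEq (Y j s)]

/-- Reducing a tensor product of maps amounts to reducing each of them. -/
theorem reduced_tensorMap (Φ : ∀ j, Matrix (X j) (X j) ℂ →ₗ[ℂ] Matrix (∀ s, Y j s) (∀ s, Y j s) ℂ)
    (V : ∀ j, Finset (S j)) (τ : Matrix (∀ j, X j) (∀ j, X j) ℂ)
    (a b : ∀ p : {p : Σ j, S j // p ∈ Finset.univ.sigma V}, Y p.1.1 p.1.2) :
    reduced (X := fun p : Σ j, S j => Y p.1 p.2) (Finset.univ.sigma V) (tensorMap Φ τ) a b =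
      piMap (fun j => reducedMap (V j) ∘ₗ Φ j) τ (sigmaLabels V a) (sigmaLabels V b) := by
  have hglue : ∀ (a : ∀ p : {p : Σ j, S j // p ∈ Finset.univ.sigma V}, Y p.1.1 p.1.2)
      (c : ∀ j, ∀ s : {s // s ∉ V j}, Y j s) (j : ι),
      (fun s => glue (X := fun p : Σ j, S j => Y p.1 p.2) (Finset.univ.sigma V) a
        ((sigmaLabelsCompl V).symm c) ⟨j, s⟩) =
        glue (V j) (sigmaLabels V a j) (c j) := by
    intro a c j
    funext s
    by_cases h : s ∈ V j
    · rw [glue_mem _ _ ⟨s, h⟩]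
      exact glue_mem (X := fun p : Σ j, S j => Y p.1 p.2) _ _ ⟨⟨j, s⟩, by simp [h]⟩
    · rw [glue_not_mem _ _ ⟨s, h⟩]
      exact glue_not_mem (X := fun p : Σ j, S j => Y p.1 p.2) _ _ ⟨⟨j, s⟩, by simp [h]⟩
  change ∑ c, tensorMap Φ τ
    (glue (X := fun p : Σ j, S j => Y p.1 p.2) (Finset.univ.sigma V) a c)
    (glue (X := fun p : Σ j, S j => Y p.1 p.2) (Finset.univ.sigma V) b c) = _
  rw [← (sigmaLabelsCompl V).symm.sum_comp, piMap_apply]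
  simp only [tensorMap_apply, hglue]
  rw [Finset.sum_comm]
  refine Finset.sum_congr rfl fun x _ => ?_
  rw [Finset.sum_comm]
  refine Finset.sum_congr rfl fun x' _ => ?_
  rw [← Finset.mul_sum]
  congr 1
  simp only [LinearMap.comp_apply, reducedMap_apply]
  simp only [reduced, of_apply]
  rw [Fintype.prod_sum]

end Concat

/-! ### Recovery and secrecy of concatenated schemes. -/

section ConcatScheme

variable {σ : Type} [Fintype σ] {P : Type} (T : Encoding σ)
  (Q : ∀ j : T.Share, Scheme (T.Basis j) P)

/-- The shares of the concatenated scheme that are selected by `V j` among those of `Q j`. -/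
def sigmaShares (V : ∀ j, Finset (Q j).Share) : Finset (Scheme.concat T Q).Share :=
  Finset.univ.sigma V

/-- The labels of the selected shares, grouped by the shares of `T`. -/
def sigmaSharesLabels (V : ∀ j, Finset (Q j).Share) :
    (∀ p : {p // p ∈ sigmaShares T Q V}, (Scheme.concat T Q).Basis p) ≃
      ∀ j, ∀ s : {s // s ∈ V j}, (Q j).Basis s :=
  sigmaLabels (Y := fun j s => (Q j).Basis s) V

theorem reduced_concat (V : ∀ j, Finset (Q j).Share) (ρ : Matrix σ σ ℂ) :
    reduced (sigmaShares T Q V) ((Scheme.concat T Q).encode ρ) =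
      (piMap (fun j => reducedMap (V j) ∘ₗ (Q j).encode) (T.encode ρ)).submatrix
        (sigmaSharesLabels T Q V) (sigmaSharesLabels T Q V) := by
  ext a b
  exact reduced_tensorMap (Y := fun j s => (Q j).Basis s) (fun j => (Q j).encode) V _ a b

/-- Decode the shares in `J` one by one and replace every other share by a fixed basis state; the
result agrees on `J` with the outer encoding, to which the outer recovery applies. Partial
information in blocks outside `J` is simply thrown away. -/
theorem recovers_concat [∀ j, Nonempty (T.Basis j)] {V : ∀ j, Finset (Q j).Share}
    {J : Finset T.Share} (hT : T.Recovers J) (hQ : ∀ j ∈ J, (Q j).Recovers (V j)) :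
    (Scheme.concat T Q).Recovers (sigmaShares T Q V) := by
  obtain ⟨R, hR, hRρ⟩ := hT
  have hD : ∀ j, ∃ (D : Matrix (∀ i : {i // i ∈ V j}, (Q j).Basis i)
      (∀ i : {i // i ∈ V j}, (Q j).Basis i) ℂ →ₗ[ℂ] Matrix (T.Basis j) (T.Basis j) ℂ)
      (ω : Matrix (T.Basis j) (T.Basis j) ℂ), IsChannel D ∧ ω.trace = 1 ∧
      (j ∈ J → ∀ τ, D (reduced (V j) ((Q j).encode τ)) = τ) ∧
      (j ∉ J → ∀ τ, D (reduced (V j) ((Q j).encode τ)) = τ.trace • ω) := by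
    intro j
    obtain ⟨x⟩ := ‹∀ j, Nonempty (T.Basis j)› j
    by_cases h : j ∈ J
    · obtain ⟨D, hD, hDτ⟩ := hQ j h
      exact ⟨D, Matrix.single x x 1, hD, by simp, fun _ => hDτ, fun h' => absurd h h'⟩
    · obtain ⟨D, hD, hDτ⟩ := exists_isChannel_const
        (n := ∀ i : {i // i ∈ V j}, (Q j).Basis i) x
      refine ⟨D, Matrix.single x x 1, hD, by simp, fun h' => absurd h' h, fun _ τ => ?_⟩
      rw [hDτ, trace_reduced, (Q j).isChannel.2]
  choose D ω hD hω hDJ hDω using hD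
  let e := sigmaSharesLabels T Q V
  refine ⟨R ∘ₗ reducedMap J ∘ₗ piMap D ∘ₗ relabel (fun a => (e a, ())), hR.comp
    ((isChannel_reducedMap J).comp ((isChannel_piMap hD).comp (isChannel_relabel_unit e))),
    fun ρ => ?_⟩
  have he : relabel (fun a => (e a, ()))
      (reduced (sigmaShares T Q V) ((Scheme.concat T Q).encode ρ)) =
      piMap (fun j => reducedMap (V j) ∘ₗ (Q j).encode) (T.encode ρ) := by
    ext y y'
    rw [relabel_unit_apply, reduced_concat, submatrix_apply, Equiv.apply_symm_apply,
      Equiv.apply_symm_apply]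
  simp only [LinearMap.comp_apply]
  rw [he, piMap_piMap, reducedMap_apply, reduced_piMap J _ (fun j => ω j) (fun j => hω j) ?_ ?_,
    hRρ]
  · intro j τ
    simp only [LinearMap.comp_apply, reducedMap_apply]
    exact hDω j j.2 τ
  · intro j hj τ
    simp only [LinearMap.comp_apply, reducedMap_apply]
    exact hDJ j hj τ

/-- Blocks outside `J` contribute fixed operators, so the reduced operator is a function of the
outer state on `J` alone. Nothing is asked of the blocks in `J`: they may be revealed completely. -/
theorem hides_concat {V : ∀ j, Finset (Q j).Share} {J : Finset T.Share} (hT : T.Hides J)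
    (hQ : ∀ j ∉ J, (Q j).Hides (V j)) : (Scheme.concat T Q).Hides (sigmaShares T Q V) := by
  obtain ⟨ω, hω⟩ := hT
  choose η hη using hQ
  let Ψ := fun j => reducedMap (V j) ∘ₗ (Q j).encode
  have hΨ : ∀ (j : {j // j ∉ J}) τ, Ψ j τ = τ.trace • η j j.2 := fun j τ => by
    simp only [Ψ, LinearMap.comp_apply, reducedMap_apply, hη j j.2]
  let ζ : Matrix (∀ j, ∀ s : {s // s ∈ V j}, (Q j).Basis s)
      (∀ j, ∀ s : {s // s ∈ V j}, (Q j).Basis s) ℂ := Matrix.of fun y y' =>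
    ∑ u : (∀ j : {j // j ∈ J}, T.Basis j), ∑ u' : (∀ j : {j // j ∈ J}, T.Basis j),
      ω u u' * ((∏ j : {j // j ∈ J}, Ψ j (Matrix.single (u j) (u' j) 1) (y j) (y' j)) *
        ∏ j : {j // j ∉ J}, η j j.2 (y j) (y' j))
  refine ⟨ζ.submatrix (sigmaSharesLabels T Q V) (sigmaSharesLabels T Q V), fun ρ => ?_⟩
  rw [reduced_concat]
  have : piMap Ψ (T.encode ρ) = ρ.trace • ζ := by
    ext y y'
    rw [piMap_apply_of_forget J Ψ (fun j => η j j.2) hΨ, hω]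
    simp only [ζ, Matrix.smul_apply, of_apply, smul_eq_mul, Finset.mul_sum, mul_assoc]
  rw [this]
  rfl

end ConcatScheme

/-! ### Secret sharing for access structures without disjoint authorized sets -/

section AdditiveCode

variable {I σ : Type} [Fintype I] [DecidableEq I] [AddCommGroup σ]

/-- The code of additive sharings: for every authorized `α` the secret is the sum of the entries
`c i α` with `i ∈ α`. -/
def additiveCode (σ : Type) [AddCommGroup σ] (Δ : Finset I → Prop) :
    AddSubgroup (I → Finset I → σ) where
  carrier := {c | (∀ α, ∀ i ∉ α, c i α = 0) ∧
    ∀ α, Δ α → ∑ i, c i α = ∑ i, c i Finset.univ}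
  zero_mem' := by simp
  add_mem' := by
    rintro c c' ⟨h1, h2⟩ ⟨h1', h2'⟩
    refine ⟨fun α i hi => by simp [h1 α i hi, h1' α i hi], fun α hα => ?_⟩
    simp [Finset.sum_add_distrib, h2 α hα, h2' α hα]
  neg_mem' := by
    rintro c ⟨h1, h2⟩
    refine ⟨fun α i hi => by simp [h1 α i hi], fun α hα => ?_⟩
    simp [h2 α hα]

/-- The secret carried by a codeword. -/
def secretOf : (I → Finset I → σ) →+ σ where
  toFun c := ∑ i, c i Finset.univ
  map_zero' := by simp
  map_add' c c' := by simp [Finset.sum_add_distrib]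

theorem secretOf_eq_zero {Δ : Finset I → Prop} {A : Finset I} (hA : Δ A)
    {c : I → Finset I → σ} (hc : c ∈ additiveCode σ Δ) (h0 : ∀ i ∈ A, c i = 0) :
    secretOf c = 0 := by
  change ∑ i, c i Finset.univ = 0
  rw [← hc.2 A hA]
  refine Finset.sum_eq_zero fun i _ => ?_
  by_cases hi : i ∈ A
  · rw [h0 i hi]; rfl
  · exact hc.1 A i hi

/-- By monotonicity no authorized `α` is contained in `A`, so in the sharing attached to `α` the
whole secret `g` can be given to a member of `α` outside `A`. -/
theorem exists_codeword {Δ : Finset I → Prop} (hmono : ∀ A B, Δ A → A ⊆ B → Δ B)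
    (huniv : Δ Finset.univ) {A : Finset I} (hA : ¬ Δ A) (g : σ) :
    ∃ c ∈ additiveCode σ Δ, (∀ i ∈ A, c i = 0) ∧ secretOf c = g := by
  classical
  have h : ∀ α, Δ α → ∃ i ∈ α, i ∉ A := by
    intro α hα
    by_contra! hsub
    exact hA (hmono α A hα hsub)
  choose pick hpick hpickA using h
  let c : I → Finset I → σ := fun i α => if hα : Δ α then (if i = pick α hα then g else 0) else 0
  have hsum : ∀ α, Δ α → ∑ i, c i α = g := by
    intro α hα
    simp [c, hα]
  refine ⟨c, ⟨fun α i hi => ?_, fun α hα => ?_⟩, fun i hi => ?_, hsum _ huniv⟩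
  · by_cases hα : Δ α
    · have : i ≠ pick α hα := fun h => hi (h ▸ hpick α hα)
      simp [c, this]
    · simp [c, hα]
  · rw [hsum α hα, hsum _ huniv]
  · funext α
    by_cases hα : Δ α
    · have : i ≠ pick α hα := fun h => hpickA α hα (h ▸ hi)
      simp [c, this]
    · simp [c, hα]

end AdditiveCode

/-! ### The self-dual extension by one player and its sharing scheme. -/

section Sharing

variable {P : Type} [Fintype P] [DecidableEq P]

/-- Monotone access structures in which any two authorized sets overlap. -/
structure IsShareable (Γ : Finset (Finset P)) : Prop where
  mono : ∀ A ∈ Γ, ∀ B, A ⊆ B → B ∈ Γ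
  inter : ∀ A ∈ Γ, ∀ B ∈ Γ, (A ∩ B).Nonempty

/-- Add a player `none` such that of two complementary sets exactly one is authorized. -/
def selfDual (Γ : Finset (Finset P)) (A : Finset (Option P)) : Prop :=
  (none ∈ A ∧ A.eraseNoneᶜ ∉ Γ) ∨ (none ∉ A ∧ A.eraseNone ∈ Γ)

/-- The case that needs intersecting members is `none ∈ B` but `none ∉ A`: were the complement of
`B` authorized, it would be disjoint from the authorized part of `A`. -/
theorem IsShareable.selfDual_mono {Γ : Finset (Finset P)} (hΓ : IsShareable Γ)
    (A B : Finset (Option P)) (hA : selfDual Γ A) (hAB : A ⊆ B) : selfDual Γ B := by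
  have hAB' : A.eraseNone ⊆ B.eraseNone := fun i hi => by
    rw [Finset.mem_eraseNone] at hi ⊢
    exact hAB hi
  by_cases hB : none ∈ B
  · refine Or.inl ⟨hB, fun hBΓ => ?_⟩
    rcases hA with ⟨_, hA⟩ | ⟨_, hA⟩
    · exact hA (hΓ.mono _ hBΓ _ (Finset.compl_subset_compl.mpr hAB'))
    · obtain ⟨i, hi⟩ := hΓ.inter _ hA _ hBΓ
      rw [Finset.mem_inter, Finset.mem_compl] at hi
      exact hi.2 (hAB' hi.1)
  · rcases hA with ⟨hA, _⟩ | ⟨_, hA⟩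
    · exact absurd (hAB hA) hB
    · exact Or.inr ⟨hB, hΓ.mono _ hA _ hAB'⟩

omit [Fintype P] in
theorem IsShareable.empty_notMem {Γ : Finset (Finset P)} (hΓ : IsShareable Γ) : ∅ ∉ Γ :=
  fun h => by simpa using hΓ.inter _ h _ h

theorem IsShareable.selfDual_univ {Γ : Finset (Finset P)} (hΓ : IsShareable Γ) :
    selfDual Γ Finset.univ := by
  refine Or.inl ⟨Finset.mem_univ _, ?_⟩
  have : (Finset.univ : Finset (Option P)).eraseNoneᶜ = ∅ := by
    ext i; simp
  rw [this]
  exact hΓ.empty_notMem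

theorem selfDual_map_some {Γ : Finset (Finset P)} (S : Finset P) :
    selfDual Γ (S.map Function.Embedding.some) ↔ S ∈ Γ := by
  simp [selfDual]

/-- `Finset.insertNone Sᶜ` is the complement of `S` among the extended players; with
`selfDual_map_some` this is the self-duality. -/
theorem selfDual_insertNone_compl {Γ : Finset (Finset P)} (S : Finset P) :
    selfDual Γ (Finset.insertNone Sᶜ) ↔ S ∉ Γ := by
  simp [selfDual]

/-- Vectors indexed by `Option P`, split into the entries in `S` and all others. -/
def splitOption (S : Finset P) (X : Type) [AddCommGroup X] :
    (∀ _ : {i // i ∈ S}, X) × ((∀ _ : {i // i ∉ S}, X) × X) ≃+ (Option P → X) where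
  toFun p o := o.elim p.2.2 fun i => if h : i ∈ S then p.1 ⟨i, h⟩ else p.2.1 ⟨i, h⟩
  invFun w := (fun i => w (some i), fun i => w (some i), w none)
  left_inv p := by
    refine Prod.ext (funext fun i => ?_) (Prod.ext (funext fun i => ?_) rfl)
    · simp
    · simp [i.2]
  right_inv w := by
    funext o
    cases o <;> simp
  map_add' p q := by
    funext o
    cases o with
    | none => rfl
    | some i => by_cases h : i ∈ S <;> simp [h]

/-- Vectors indexed by `Option P`, split into the entries in `P` and the entry at `none`. -/
def splitNone (P X : Type) [AddCommGroup X] : (P → X) × X ≃+ (Option P → X) where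
  toFun p o := o.elim p.2 p.1
  invFun w := (fun i => w (some i), w none)
  left_inv _ := rfl
  right_inv w := by
    funext o
    cases o <;> rfl
  map_add' p q := by
    funext o
    cases o <;> rfl

variable (σ : Type) [Fintype σ] [DecidableEq σ] [AddCommGroup σ]

/-- The encoding with one share for each player by a superposition of additive sharings, the
share of the additional player being discarded. -/
noncomputable def sharing {Γ : Finset (Finset P)} (hΓ : IsShareable Γ) : Encoding σ where
  Share := P
  Basis := fun _ => Finset (Option P) → σ
  encode := codeState (splitNone P (Finset (Option P) → σ)) (additiveCode σ (selfDual Γ)) secretOf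
  isChannel := isChannel_codeState _ fun g => by
    -- Since the empty set is unauthorized, every secret is carried by some codeword.
    have h : ¬ selfDual Γ ∅ := by
      simpa [selfDual] using hΓ.empty_notMem
    obtain ⟨c, hc, -, hg⟩ := exists_codeword hΓ.selfDual_mono hΓ.selfDual_univ h g
    exact ⟨c, hc, hg⟩

/-- A share must itself serve as the secret of an inner scheme, and secrets are elements of a group.
-/
instance sharingBasisAddCommGroup {Γ : Finset (Finset P)} (hΓ : IsShareable Γ)
    (j : (sharing σ hΓ).Share) : AddCommGroup ((sharing σ hΓ).Basis j) :=
  (Pi.addCommGroup : AddCommGroup (Finset (Option P) → σ))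

/-- Tracing out the shares outside `S` only enlarges the environment from the extra player to the
full complement of `S`. -/
theorem reduced_sharing {Γ : Finset (Finset P)} (hΓ : IsShareable Γ) (S : Finset P)
    (ρ : Matrix σ σ ℂ) : reduced (X := fun _ => Finset (Option P) → σ) S
      ((sharing σ hΓ).encode ρ) =
      codeState (splitOption S (Finset (Option P) → σ)) (additiveCode σ (selfDual Γ))
        secretOf ρ := by
  classical
  ext a b
  have hsplit : ∀ (a : ∀ _ : {i // i ∈ S}, Finset (Option P) → σ)
      (c : ∀ _ : {i // i ∉ S}, Finset (Option P) → σ) (z : Finset (Option P) → σ),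
      splitNone P (Finset (Option P) → σ) (glue S a c, z) =
        splitOption S (Finset (Option P) → σ) (a, (c, z)) := by
    intro a c z
    funext o
    cases o <;> rfl
  rw [codeState_apply, Fintype.sum_prod_type, Finset.mul_sum]
  simp only [← hsplit]
  rfl

/-- `S` is authorized in the self-dual extension and determines the secret; its complement is not,
and so can be zero for every secret. -/
theorem sharing_recovers {Γ : Finset (Finset P)} (hΓ : IsShareable Γ) {S : Finset P}
    (hS : S ∈ Γ) : (sharing σ hΓ).Recovers S := by
  suffices hR : ∃ R : Matrix (∀ _ : {i // i ∈ S}, Finset (Option P) → σ)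
      (∀ _ : {i // i ∈ S}, Finset (Option P) → σ) ℂ →ₗ[ℂ] Matrix σ σ ℂ, IsChannel R ∧
      ∀ ρ, R (codeState (splitOption S (Finset (Option P) → σ)) (additiveCode σ (selfDual Γ))
        secretOf ρ) = ρ by
    obtain ⟨R, hR, h⟩ := hR
    exact ⟨R, hR, fun ρ => (congrArg R (reduced_sharing σ hΓ S ρ)).trans (h ρ)⟩
  refine exists_recovery_codeState _ (fun e he => ?_) (fun g => ?_)
  · refine secretOf_eq_zero ((selfDual_map_some S).mpr hS) he fun i hi => ?_
    obtain ⟨i, hiS, rfl⟩ := Finset.mem_map.mp hi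
    simp [splitOption, hiS]
  · obtain ⟨c, hc, h0, hg⟩ := exists_codeword (σ := σ) hΓ.selfDual_mono hΓ.selfDual_univ
      (A := Finset.insertNone Sᶜ) (by simpa [selfDual_insertNone_compl] using hS) g
    have : splitOption S (Finset (Option P) → σ) (fun i => c (some i), 0) = c := by
      funext o
      cases o with
      | none => simp [splitOption, h0 none (by simp)]
      | some i =>
        by_cases hi : i ∈ S
        · simp [splitOption, hi]
        · simp [splitOption, hi, h0 (some i) (by simp [hi])]
    exact ⟨fun i => c (some i), this.symm ▸ hc, this.symm ▸ hg⟩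

/-- The cut of `sharing_recovers` with both sides exchanged: here the complement of `S` is
authorized. -/
theorem sharing_hides {Γ : Finset (Finset P)} (hΓ : IsShareable Γ) {S : Finset P}
    (hS : S ∉ Γ) : (sharing σ hΓ).Hides S := by
  suffices hω : ∃ ω, ∀ ρ, codeState (splitOption S (Finset (Option P) → σ))
      (additiveCode σ (selfDual Γ)) secretOf ρ = ρ.trace • ω by
    obtain ⟨ω, h⟩ := hω
    exact ⟨ω, fun ρ => (reduced_sharing σ hΓ S ρ).trans (h ρ)⟩
  refine exists_codeState_eq_trace_smul _ (fun a ha => ?_) (fun g => ?_)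
  · refine secretOf_eq_zero ((selfDual_insertNone_compl S).mpr hS) ha fun o ho => ?_
    cases o with
    | none => rfl
    | some i =>
      have hi : i ∉ S := by simpa using ho
      simp [splitOption, hi]
  · obtain ⟨c, hc, h0, hg⟩ := exists_codeword (σ := σ) hΓ.selfDual_mono hΓ.selfDual_univ
      (A := S.map Function.Embedding.some) (by rwa [selfDual_map_some]) g
    have : splitOption S (Finset (Option P) → σ) (0, (fun i => c (some i), c none)) = c := by
      funext o
      cases o with
      | none => simp [splitOption]
      | some i =>
        by_cases hi : i ∈ S
        · simp [splitOption, hi, h0 (some i) (by simp [hi])]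
        · simp [splitOption, hi]
    exact ⟨(fun i => c (some i), c none), this.symm ▸ hc, this.symm ▸ hg⟩

/-- The scheme in which every player receives its share of `sharing`. -/
noncomputable def sharingScheme {Γ : Finset (Finset P)} (hΓ : IsShareable Γ) : Scheme σ P where
  toEncoding := sharing σ hΓ
  owner := some

theorem available_sharingScheme {Γ : Finset (Finset P)} (hΓ : IsShareable Γ) (A : Finset P) :
    (sharingScheme σ hΓ).available A = A := by
  ext i
  simp only [Scheme.available, Finset.mem_filter, Finset.mem_univ, true_and]
  constructor
  · rintro (h | ⟨p, hp, h⟩)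
    · exact absurd h (Option.some_ne_none i)
    · exact Option.some.inj h ▸ hp
  · exact fun h => Or.inr ⟨i, h, rfl⟩

theorem homeCount_sharingScheme {Γ : Finset (Finset P)} (hΓ : IsShareable Γ) :
    (sharingScheme σ hΓ).homeCount = 0 := by
  simp [Scheme.homeCount, sharingScheme]

theorem realizesConventionally_sharingScheme {Γ : Finset (Finset P)} (hΓ : IsShareable Γ)
    [Nonempty P] : (sharingScheme σ hΓ).RealizesConventionally Γ := by
  refine ⟨⟨?_, fun A => ⟨fun hA => ?_, fun hA => ?_⟩⟩, homeCount_sharingScheme σ hΓ⟩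
  · rw [homeCount_sharingScheme]
    exact Fintype.card_pos (α := P)
  · rw [available_sharingScheme]
    exact (sharing_recovers σ hΓ hA).canRecover
  · rw [available_sharingScheme]
    exact (sharing_hides σ hΓ hA).noInformation

end Sharing

/-! ### Secrecy and inclusion of share sets -/

section Mono

variable {ι : Type} [Fintype ι] [DecidableEq ι] {X : ι → Type}

/-- Labels outside `S`, split into those in `S'` and those outside `S'`. -/
def splitCompl {S S' : Finset ι} (h : S ⊆ S') :
    (∀ i : {i // i ∈ S' ∧ i ∉ S}, X i) × (∀ i : {i // i ∉ S'}, X i) ≃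
      ∀ i : {i // i ∉ S}, X i where
  toFun p i := if hi : i.1 ∈ S' then p.1 ⟨i, hi, i.2⟩ else p.2 ⟨i, hi⟩
  invFun c := (fun i => c ⟨i, i.2.2⟩, fun i => c ⟨i, fun hi => i.2 (h hi)⟩)
  left_inv p := by
    refine Prod.ext (funext fun i => ?_) (funext fun i => ?_)
    · simp [i.2.1]
    · simp [i.2]
  right_inv c := by
    funext i
    by_cases hi : i.1 ∈ S' <;> simp [hi]

/-- A partial trace can be taken in two stages: first outside `S'`, then over `S' \ S`. -/
theorem reduced_eq_sum_reduced [∀ i, Fintype (X i)] {S S' : Finset ι} (h : S ⊆ S')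
    (τ : Matrix (∀ i, X i) (∀ i, X i) ℂ) (a b : ∀ i : {i // i ∈ S}, X i) :
    reduced S τ a b = ∑ d : (∀ i : {i // i ∈ S' ∧ i ∉ S}, X i), reduced S' τ
      (fun i => if hi : i.1 ∈ S then a ⟨i, hi⟩ else d ⟨i, i.2, hi⟩)
      (fun i => if hi : i.1 ∈ S then b ⟨i, hi⟩ else d ⟨i, i.2, hi⟩) := by
  have hglue : ∀ (a : ∀ i : {i // i ∈ S}, X i) (d : ∀ i : {i // i ∈ S' ∧ i ∉ S}, X i)
      (c : ∀ i : {i // i ∉ S'}, X i), glue S a (splitCompl h (d, c)) =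
        glue S' (fun i => if hi : i.1 ∈ S then a ⟨i, hi⟩ else d ⟨i, i.2, hi⟩) c := by
    intro a d c
    funext i
    by_cases hi' : i ∈ S'
    · rw [glue_mem _ _ ⟨i, hi'⟩]
      by_cases hi : i ∈ S
      · rw [glue_mem _ _ ⟨i, hi⟩]
        simp [hi]
      · rw [glue_not_mem _ _ ⟨i, hi⟩]
        simp [hi, hi', splitCompl]
    · have hi : i ∉ S := fun hi => hi' (h hi)
      rw [glue_not_mem _ _ ⟨i, hi'⟩, glue_not_mem _ _ ⟨i, hi⟩]
      simp [hi', splitCompl]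
  change ∑ c, τ (glue S a c) (glue S b c) = ∑ d, ∑ c, τ (glue S' _ c) (glue S' _ c)
  rw [← (splitCompl h).sum_comp, Fintype.sum_prod_type]
  simp only [hglue]

end Mono

theorem Encoding.NoInformation.mono {σ : Type} [Fintype σ] {E : Encoding σ}
    {S S' : Finset E.Share} (h : S ⊆ S') (hS' : E.NoInformation S') : E.NoInformation S := by
  intro ρ τ hρ hτ
  ext a b
  rw [reduced_eq_sum_reduced h, reduced_eq_sum_reduced h, hS' ρ τ hρ hτ]

open scoped ComplexOrder in
theorem isDensity_single {n : Type} [Fintype n] [DecidableEq n] (i : n) :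
    IsDensity (Matrix.single i i (1 : ℂ)) := by
  refine ⟨?_, by simp⟩
  rw [← Matrix.diagonal_single]
  refine Matrix.PosSemidef.diagonal fun j => ?_
  by_cases h : j = i
  · subst h; simp
  · simp [h]

/-- The same shares cannot both reconstruct and be independent of a non-trivial secret. -/
theorem Encoding.CanRecover.not_noInformation {σ : Type} [Fintype σ] [Nontrivial σ]
    {E : Encoding σ} {S : Finset E.Share} (h : E.CanRecover S) : ¬ E.NoInformation S := by
  classical
  intro h'
  obtain ⟨R, -, hR⟩ := h
  obtain ⟨i, j, hij⟩ := exists_pair_ne σ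
  have hi := hR _ (isDensity_single i)
  rw [h' _ _ (isDensity_single i) (isDensity_single j), hR _ (isDensity_single j)] at hi
  have := congrFun (congrFun hi i) i
  simp [hij.symm] at this

/-- If `B` were unauthorized, the smaller share set of `A` would inherit its ignorance and still
reconstruct. -/
theorem Scheme.Realizes.mono {σ : Type} [Fintype σ] [Nontrivial σ] {P : Type} [DecidableEq P]
    {𝒮 : Scheme σ P} {Γ : Finset (Finset P)} (h : 𝒮.Realizes Γ) :
    ∀ A ∈ Γ, ∀ B : Finset P, A ⊆ B → B ∈ Γ := by
  intro A hA B hAB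
  by_contra hB
  refine ((h.2 A).1 hA).not_noInformation (((h.2 B).2 hB).mono fun i hi => ?_)
  simp only [Scheme.available, Finset.mem_filter, Finset.mem_univ, true_and] at hi ⊢
  exact hi.imp_right fun ⟨p, hp, hi⟩ => ⟨p, hAB hp, hi⟩

/-! ### Distribution of the shares of a concatenation -/

section ConcatHome

variable {σ : Type} [Fintype σ] {P : Type} [DecidableEq P]

theorem available_concat (T : Encoding σ) (Q : ∀ j : T.Share, Scheme (T.Basis j) P)
    (A : Finset P) : (Scheme.concat T Q).available A =
      sigmaShares T Q fun j => (Q j).available A := by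
  ext p
  refine Iff.trans ?_ Finset.mem_sigma.symm
  simp only [Scheme.available, Finset.mem_filter, Finset.mem_univ, true_and]
  rfl

theorem homeCount_concat (T : Encoding σ) (Q : ∀ j : T.Share, Scheme (T.Basis j) P) :
    (Scheme.concat T Q).homeCount = ∑ j, (Q j).homeCount := by
  simp only [Scheme.homeCount]
  rw [← Finset.card_sigma]
  congr 1
  ext p
  refine Iff.trans ?_ Finset.mem_sigma.symm
  simp only [Finset.mem_filter, Finset.mem_univ, true_and]
  rfl

theorem homeCount_keep [DecidableEq σ] : (Scheme.keep σ P).homeCount = 1 := by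
  have : (Finset.univ.filter fun i => (Scheme.keep σ P).owner i = none) = Finset.univ :=
    Finset.filter_true_of_mem fun _ _ => rfl
  rw [Scheme.homeCount, this]
  rfl

theorem recovers_keep [DecidableEq σ] (A : Finset P) :
    (Scheme.keep σ P).Recovers ((Scheme.keep σ P).available A) := by
  have hmem : ∀ i, i ∈ (Scheme.keep σ P).available A := fun i =>
    Finset.mem_filter.mpr ⟨Finset.mem_univ _, Or.inl rfl⟩
  let e : (∀ i : {i // i ∈ (Scheme.keep σ P).available A}, (Scheme.keep σ P).Basis i) ≃ σ :=
    ⟨fun a => a ⟨(), hmem ()⟩, fun s _ => s, fun _ => rfl, fun _ => rfl⟩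
  refine ⟨relabel fun a => (e a, ()), isChannel_relabel_unit e, fun ρ => ?_⟩
  ext s s'
  rw [relabel_unit_apply]
  have : IsEmpty {i // i ∉ (Scheme.keep σ P).available A} := ⟨fun i => i.2 (hmem _)⟩
  have hval : ∀ s c, glue ((Scheme.keep σ P).available A) (e.symm s) c () = s := fun s c =>
    glue_mem _ c ⟨(), hmem ()⟩
  change ∑ c, ρ (glue _ (e.symm s) c ()) (glue _ (e.symm s') c ()) = ρ s s'
  simp only [hval]
  rw [Fintype.sum_unique]

end ConcatHome

/-! ### Partial link classifications -/

/-- Merging two parts of a partition. -/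
theorem exists_merge {α : Type} [DecidableEq α] {s : Finset α} (𝒞 : Finpartition s)
    {C D : Finset α} (hC : C ∈ 𝒞.parts) (hD : D ∈ 𝒞.parts) (hCD : C ≠ D) :
    ∃ 𝒟 : Finpartition s, 𝒟.parts = insert (C ∪ D) ((𝒞.parts.erase C).erase D) ∧
      𝒟.parts.card < 𝒞.parts.card := by
  refine ⟨Finpartition.ofExistsUnique (insert (C ∪ D) ((𝒞.parts.erase C).erase D))
    ?_ ?_ ?_, rfl, ?_⟩
  · intro t ht
    simp only [Finset.mem_insert, Finset.mem_erase] at ht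
    rcases ht with rfl | ⟨_, _, ht⟩
    · exact Finset.union_subset (𝒞.le hC) (𝒞.le hD)
    · exact 𝒞.le ht
  · intro a ha
    obtain ⟨t, ⟨ht, hat⟩, huniq⟩ := 𝒞.existsUnique_mem ha
    simp only at huniq
    by_cases h : a ∈ C ∪ D
    · refine ⟨C ∪ D, ⟨Finset.mem_insert_self _ _, h⟩, ?_⟩
      rintro u ⟨hu, hau⟩
      simp only [Finset.mem_insert, Finset.mem_erase] at hu
      rcases hu with rfl | ⟨huD, huC, hu⟩
      · rfl
      · exfalso
        have hut := huniq u ⟨hu, hau⟩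
        rcases Finset.mem_union.mp h with h | h
        · exact huC (hut.trans (huniq C ⟨hC, h⟩).symm)
        · exact huD (hut.trans (huniq D ⟨hD, h⟩).symm)
    · have htC : t ≠ C := fun h' => h (Finset.mem_union_left _ (h' ▸ hat))
      have htD : t ≠ D := fun h' => h (Finset.mem_union_right _ (h' ▸ hat))
      refine ⟨t, ⟨by simp [ht, htC, htD], hat⟩, ?_⟩
      rintro u ⟨hu, hau⟩
      simp only [Finset.mem_insert, Finset.mem_erase] at hu
      rcases hu with rfl | ⟨_, _, hu⟩
      · exact absurd hau h
      · exact huniq u ⟨hu, hau⟩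
  · simp only [Finset.mem_insert, Finset.mem_erase, not_or]
    refine ⟨fun h => ?_, fun h => 𝒞.bot_notMem h.2.2⟩
    exact (𝒞.nonempty_of_mem_parts hC).ne_empty (Finset.union_eq_empty.mp h.symm).1
  · have h1 := Finset.card_erase_add_one hC
    have h2 := Finset.card_erase_add_one (Finset.mem_erase.mpr ⟨hCD.symm, hD⟩)
    have h3 := Finset.card_insert_le (C ∪ D) ((𝒞.parts.erase C).erase D)
    change (insert (C ∪ D) ((𝒞.parts.erase C).erase D)).card < _
    omega

/-- Two classes violating the second condition are completely linked, so their union is again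
intersecting. Merging lowers the number of classes, so the process stops. -/
theorem exists_isPartialLinkClassification_of_linked {P : Type} [DecidableEq P]
    {Γ : Finset (Finset P)} (𝒞 : Finpartition Γ)
    (h𝒞 : ∀ C ∈ 𝒞.parts, ∀ α ∈ C, ∀ β ∈ C, (α ∩ β).Nonempty) :
    ∃ 𝒟 : Finpartition Γ, IsPartialLinkClassification 𝒟 := by
  induction hn : 𝒞.parts.card using Nat.strong_induction_on generalizing 𝒞 with
  | _ n ih =>
    by_cases h : IsPartialLinkClassification 𝒞
    · exact ⟨𝒞, h⟩
    · simp only [IsPartialLinkClassification, not_and] at h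
      have h' := h h𝒞
      push Not at h'
      obtain ⟨C, hC, D, hD, hCD, hlink⟩ := h'
      obtain ⟨𝒟, hparts, hcard⟩ := exists_merge 𝒞 hC hD hCD
      refine ih _ (hn ▸ hcard) 𝒟 ?_ rfl
      intro F hF α hα β hβ
      rw [hparts] at hF
      simp only [Finset.mem_insert, Finset.mem_erase] at hF
      rcases hF with rfl | ⟨_, _, hF⟩
      · rcases Finset.mem_union.mp hα with hα | hα <;> rcases Finset.mem_union.mp hβ with hβ | hβ
        · exact h𝒞 C hC α hα β hβ
        · exact hlink α hα β hβ
        · rw [Finset.inter_comm]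
          exact hlink β hβ α hα
        · exact h𝒞 D hD α hα β hβ
      · exact h𝒞 F hF α hα β hβ

/-- The partition into singletons starts the merging, as a non-empty set meets itself. Hence the
infimum defining `linkNumber` is attained and not the default `0` of an empty set. -/
theorem exists_card_eq_linkNumber {P : Type} [DecidableEq P] {Γ : Finset (Finset P)}
    (hempty : ∅ ∉ Γ) : ∃ 𝒞 : Finpartition Γ, IsPartialLinkClassification 𝒞 ∧
      𝒞.parts.card = linkNumber Γ := by
  obtain ⟨𝒟, h𝒟⟩ := exists_isPartialLinkClassification_of_linked (⊥ : Finpartition Γ) (by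
    intro C hC α hα β hβ
    obtain ⟨γ, hγ, rfl⟩ := Finpartition.mem_bot_iff.mp hC
    rw [Finset.mem_singleton.mp hα, Finset.mem_singleton.mp hβ, Finset.inter_self]
    exact Finset.nonempty_iff_ne_empty.mpr fun h => hempty (h ▸ hγ))
  exact Nat.sInf_mem (s := {n | ∃ 𝒞 : Finpartition Γ, IsPartialLinkClassification 𝒞 ∧
    𝒞.parts.card = n}) ⟨_, 𝒟, h𝒟, rfl⟩

theorem isShareable_generated {P : Type} [Fintype P] [DecidableEq P] {C : Finset (Finset P)}
    (hC : ∀ α ∈ C, ∀ β ∈ C, (α ∩ β).Nonempty) : IsShareable (generated C) where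
  mono A hA B hAB := by
    simp only [generated, Finset.mem_filter, Finset.mem_univ, true_and] at hA ⊢
    obtain ⟨α, hα, hαA⟩ := hA
    exact ⟨α, hα, hαA.trans hAB⟩
  inter A hA B hB := by
    simp only [generated, Finset.mem_filter, Finset.mem_univ, true_and] at hA hB
    obtain ⟨α, hα, hαA⟩ := hA
    obtain ⟨β, hβ, hβB⟩ := hB
    exact (hC α hα β hβ).mono (Finset.inter_subset_inter hαA hβB)

/-- Two sets of size at least `k` cannot be disjoint among fewer than `2 * k` players. -/
theorem isShareable_threshold {P : Type} [Fintype P] [DecidableEq P] {k : ℕ}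
    (hk : Fintype.card P < 2 * k) :
    IsShareable (Finset.univ.filter fun S : Finset P => k ≤ S.card) where
  mono A hA B hAB := by
    simp only [Finset.mem_filter, Finset.mem_univ, true_and] at hA ⊢
    exact hA.trans (Finset.card_le_card hAB)
  inter A hA B hB := by
    simp only [Finset.mem_filter, Finset.mem_univ, true_and] at hA hB
    rw [← Finset.card_pos]
    have h1 := Finset.card_union_add_card_inter A B
    have h2 := Finset.card_le_univ (A ∪ B)
    omega

/-! ### The construction -/

/-- Concatenating a threshold scheme with conventional schemes for the classes, the remaining
shares being kept at home. -/
theorem exists_concat_realizes {σ : Type} [Fintype σ] {P : Type} [Fintype P] [DecidableEq P]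
    [Nonempty P] (T : Encoding σ) [∀ j, AddCommGroup (T.Basis j)] {Γ : Finset (Finset P)}
    (hne : Γ.Nonempty) (hmono : ∀ A ∈ Γ, ∀ B : Finset P, A ⊆ B → B ∈ Γ) (𝒞 : Finpartition Γ)
    (h𝒞 : ∀ C ∈ 𝒞.parts, ∀ α ∈ C, ∀ β ∈ C, (α ∩ β).Nonempty)
    {f : {C // C ∈ 𝒞.parts} → T.Share} (hf : Function.Injective f)
    (hcard : Fintype.card T.Share + 1 = 2 * 𝒞.parts.card)
    (hrec : ∀ S : Finset T.Share, 𝒞.parts.card ≤ S.card → T.Recovers S)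
    (hhid : ∀ S : Finset T.Share, S.card < 𝒞.parts.card → T.Hides S) :
    ∃ Q : ∀ j : T.Share, Scheme (T.Basis j) P,
      (∀ C, (Q (f C)).RealizesConventionally (generated C.1)) ∧
      (∀ j, j ∉ Set.range f → Q j = Scheme.keep (T.Basis j) P) ∧
      (Scheme.concat T Q).Realizes Γ ∧
      (Scheme.concat T Q).homeCount + 1 = 𝒞.parts.card := by
  classical
  -- The operator-level properties are carried along with conventional realization, because the
  -- concatenation lemmas need them.
  have hQ : ∀ j, ∃ Qj : Scheme (T.Basis j) P,
      (∀ C, f C = j → Qj.RealizesConventionally (generated C.1) ∧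
        ∀ A, (A ∈ generated C.1 → Qj.Recovers (Qj.available A)) ∧
          (A ∉ generated C.1 → Qj.Hides (Qj.available A))) ∧
      (j ∉ Set.range f → Qj = Scheme.keep (T.Basis j) P) := by
    intro j
    by_cases hj : j ∈ Set.range f
    · obtain ⟨C, rfl⟩ := hj
      have hC := isShareable_generated (h𝒞 C.1 C.2)
      refine ⟨sharingScheme (T.Basis (f C)) hC, fun C' hC' => ?_,
        fun h => absurd (Set.mem_range_self C) h⟩
      obtain rfl := hf hC'
      refine ⟨realizesConventionally_sharingScheme _ hC, fun A => ?_⟩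
      rw [available_sharingScheme]
      exact ⟨sharing_recovers _ hC, sharing_hides _ hC⟩
    · exact ⟨Scheme.keep (T.Basis j) P, fun C hC => absurd ⟨C, hC⟩ hj, fun _ => rfl⟩
  choose Q hQf hQk using hQ
  have hF : (Finset.univ.image f).card = 𝒞.parts.card := by
    rw [Finset.card_image_of_injective _ hf, Finset.card_univ, Fintype.card_coe]
  have hFc := Finset.card_add_card_compl (Finset.univ.image f)
  have hmemF : ∀ j, j ∈ Finset.univ.image f ↔ j ∈ Set.range f := fun j => by simp
  have hhome : (Scheme.concat T Q).homeCount + 1 = 𝒞.parts.card := by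
    have h : ∀ j, (Q j).homeCount = if j ∈ Set.range f then 0 else 1 := by
      intro j
      by_cases hj : j ∈ Set.range f
      · obtain ⟨C, rfl⟩ := hj
        simpa using (hQf _ C rfl).1.2
      · rw [if_neg hj, hQk j hj, homeCount_keep]
    have hcompl : (Finset.univ.filter fun j => ¬ j ∈ Set.range f) = (Finset.univ.image f)ᶜ := by
      ext j
      simp
    rw [homeCount_concat, Finset.sum_congr rfl fun j _ => h j, Finset.sum_ite,
      Finset.sum_const_zero, zero_add, Finset.sum_const, smul_eq_mul, mul_one, hcompl]
    omega
  refine ⟨Q, fun C => (hQf _ C rfl).1, hQk, ⟨?_, fun A => ?_⟩, hhome⟩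
  -- Some class exists, and its conventional scheme has a share that is not a home share.
  · obtain ⟨C, hC⟩ := 𝒞.parts_nonempty hne.ne_empty
    obtain ⟨⟨hlt, -⟩, h0⟩ := (hQf _ ⟨C, hC⟩ rfl).1
    rw [h0] at hlt
    obtain ⟨s⟩ := Fintype.card_pos_iff.mp hlt
    refine Finset.card_lt_univ_of_notMem (x := ⟨f ⟨C, hC⟩, s⟩) fun hs => ?_
    have hs' : s ∈ Finset.univ.filter fun i => (Q (f ⟨C, hC⟩)).owner i = none :=
      Finset.mem_filter.mpr ⟨Finset.mem_univ _, (Finset.mem_filter.mp hs).2⟩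
    exact absurd h0 (Finset.card_pos.mpr ⟨s, hs'⟩).ne'
  · rw [available_concat]
    constructor
    · intro hA
      obtain ⟨C, ⟨hC, hAC⟩, -⟩ := 𝒞.existsUnique_mem hA
      have hgen : A ∈ generated C :=
        Finset.mem_filter.mpr ⟨Finset.mem_univ _, A, hAC, subset_rfl⟩
      have hnot : f ⟨C, hC⟩ ∉ (Finset.univ.image f)ᶜ := by simp
      have : ∀ j, Nonempty (T.Basis j) := fun j => ⟨0⟩
      -- The `λ - 1` home shares and the share of the class of `A` are just enough for the
      -- threshold.
      refine (recovers_concat T Q (J := insert (f ⟨C, hC⟩) (Finset.univ.image f)ᶜ)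
        (hrec _ ?_) fun j hj => ?_).canRecover
      · rw [Finset.card_insert_of_notMem hnot]
        omega
      · rcases Finset.mem_insert.mp hj with rfl | hj
        · exact ((hQf _ ⟨C, hC⟩ rfl).2 A).1 hgen
        · rw [Finset.mem_compl, hmemF] at hj
          rw [hQk j hj]
          exact recovers_keep A
    · intro hA
      -- The home shares are known in full but are one below the threshold.
      refine (hides_concat T Q (J := (Finset.univ.image f)ᶜ) (hhid _ (by omega))
        fun j hj => ?_).noInformation
      rw [Finset.mem_compl, not_not, hmemF] at hj
      obtain ⟨C, rfl⟩ := hj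
      refine ((hQf _ C rfl).2 A).2 fun hgen => hA ?_
      obtain ⟨α, hα, hαA⟩ := (Finset.mem_filter.mp hgen).2
      exact hmono α (𝒞.le C.2 hα) A hαA

/-- The outer code is `sharing` for the majority structure: with `λ` classes and `2λ - 1` shares,
sets of size at least `λ` intersect pairwise. Its share labels form a group, so the same
construction serves the classes. -/
theorem exists_threshold_concat {σ : Type} [Fintype σ] [DecidableEq σ] [AddCommGroup σ]
    {P : Type} [Fintype P] [DecidableEq P] [Nonempty P] {Γ : Finset (Finset P)}
    (hne : Γ.Nonempty) (hmono : ∀ A ∈ Γ, ∀ B : Finset P, A ⊆ B → B ∈ Γ) (𝒞 : Finpartition Γ)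
    (h𝒞 : ∀ C ∈ 𝒞.parts, ∀ α ∈ C, ∀ β ∈ C, (α ∩ β).Nonempty) :
    ∃ (T : Encoding σ) (f : {C // C ∈ 𝒞.parts} → T.Share)
      (Q : ∀ j : T.Share, Scheme (T.Basis j) P),
      T.IsThreshold 𝒞.parts.card (2 * 𝒞.parts.card - 1) ∧ Function.Injective f ∧
      (∀ C, (Q (f C)).RealizesConventionally (generated C.1)) ∧
      (∀ j, j ∉ Set.range f → Q j = Scheme.keep (T.Basis j) P) ∧
      (Scheme.concat T Q).Realizes Γ ∧
      (Scheme.concat T Q).homeCount + 1 = 𝒞.parts.card := by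
  have hpos : 0 < 𝒞.parts.card := Finset.card_pos.mpr (𝒞.parts_nonempty hne.ne_empty)
  have hshare := isShareable_threshold (P := Fin (2 * 𝒞.parts.card - 1)) (k := 𝒞.parts.card)
    (by rw [Fintype.card_fin]; omega)
  let T : Encoding σ := sharing σ hshare
  have hcard : Fintype.card T.Share = 2 * 𝒞.parts.card - 1 :=
    Fintype.card_fin (2 * 𝒞.parts.card - 1)
  have hrec : ∀ S : Finset T.Share, 𝒞.parts.card ≤ S.card → T.Recovers S := fun S hS =>
    sharing_recovers σ hshare (Finset.mem_filter.mpr ⟨Finset.mem_univ _, hS⟩)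
  have hhid : ∀ S : Finset T.Share, S.card < 𝒞.parts.card → T.Hides S := fun S hS =>
    sharing_hides σ hshare fun h => absurd (Finset.mem_filter.mp h).2 (not_le.mpr hS)
  let f : {C // C ∈ 𝒞.parts} → T.Share := fun C =>
    Fin.castLE (by omega : 𝒞.parts.card ≤ 2 * 𝒞.parts.card - 1) (𝒞.parts.equivFin C)
  have hf : Function.Injective f :=
    (Fin.castLE_injective _).comp 𝒞.parts.equivFin.injective
  have : ∀ j, AddCommGroup (T.Basis j) := sharingBasisAddCommGroup σ hshare
  obtain ⟨Q, hQ⟩ := exists_concat_realizes T hne hmono 𝒞 h𝒞 hf (by omega) hrec hhid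
  exact ⟨T, f, Q, ⟨hcard, fun S => ⟨fun h => (hrec S h).canRecover,
    fun h => (hhid S h).noInformation⟩⟩, hf, hQ⟩

end AQSS

/-! ### The main theorem. -/

theorem theorem1 (N d : ℕ) (hd : 2 ≤ d) (Γ : Finset (Finset (Fin N)))
    (hne : Γ.Nonempty) (hempty : ∅ ∉ Γ) :
    ((∃ 𝒮 : AQSS.Scheme (Fin d) (Fin N), 𝒮.Realizes Γ) ↔
      ∀ A ∈ Γ, ∀ B : Finset (Fin N), A ⊆ B → B ∈ Γ) ∧
    ((∀ A ∈ Γ, ∀ B : Finset (Fin N), A ⊆ B → B ∈ Γ) →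
      (∃ 𝒮 : AQSS.Scheme (Fin d) (Fin N),
        𝒮.Realizes Γ ∧ 𝒮.homeCount + 1 ≤ AQSS.linkNumber Γ) ∧
      ∀ 𝒞 : Finpartition Γ, AQSS.IsPartialLinkClassification 𝒞 →
        𝒞.parts.card = AQSS.linkNumber Γ →
        ∃ (T : AQSS.Encoding (Fin d))
          (f : {C // C ∈ 𝒞.parts} → T.Share)
          (Q : ∀ j : T.Share, AQSS.Scheme (T.Basis j) (Fin N)),
          T.IsThreshold (AQSS.linkNumber Γ) (2 * AQSS.linkNumber Γ - 1) ∧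
          Function.Injective f ∧
          (∀ C, (Q (f C)).RealizesConventionally (AQSS.generated C.1)) ∧
          (∀ j, j ∉ Set.range f → Q j = AQSS.Scheme.keep (T.Basis j) (Fin N)) ∧
          (AQSS.Scheme.concat T Q).Realizes Γ ∧
          (AQSS.Scheme.concat T Q).homeCount + 1 = AQSS.linkNumber Γ) := by
  -- Makes `Fin d` the cyclic group of order `d`, the group of secrets for the codes.
  have : NeZero d := ⟨by omega⟩
  have : Nontrivial (Fin d) := Fin.nontrivial_iff_two_le.mpr hd
  have : Nonempty (Fin N) := by
    obtain ⟨A, hA⟩ := hne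
    obtain ⟨p, -⟩ := Finset.nonempty_iff_ne_empty.mpr fun h : A = ∅ => hempty (h ▸ hA)
    exact ⟨p⟩
  obtain ⟨𝒟, h𝒟, hcard⟩ := AQSS.exists_card_eq_linkNumber hempty
  have hex : (∀ A ∈ Γ, ∀ B : Finset (Fin N), A ⊆ B → B ∈ Γ) →
      ∃ 𝒮 : AQSS.Scheme (Fin d) (Fin N),
        𝒮.Realizes Γ ∧ 𝒮.homeCount + 1 ≤ AQSS.linkNumber Γ := by
    intro hmono
    obtain ⟨T, f, Q, -, -, -, -, hreal, hhome⟩ :=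
      AQSS.exists_threshold_concat (σ := Fin d) hne hmono 𝒟 h𝒟.1
    exact ⟨AQSS.Scheme.concat T Q, hreal, (hhome.trans hcard).le⟩
  refine ⟨⟨fun ⟨𝒮, h𝒮⟩ => h𝒮.mono, fun hmono => ?_⟩, fun hmono => ⟨hex hmono, ?_⟩⟩
  · obtain ⟨𝒮, h𝒮, -⟩ := hex hmono
    exact ⟨𝒮, h𝒮⟩
  · intro 𝒞 h𝒞 h𝒞card
    rw [← h𝒞card]
    exact AQSS.exists_threshold_concat hne hmono 𝒞 h𝒞.1
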